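/- Let $p\ge 1$. For a skew-symmetric endomorphism $F$ of Minkowski space $\mathbb M^{1,n+1}$ written as $F=\begin{pmatrix}0&-\nu&-a^t+b^t/2\\-\nu&0&-a^t-b^t/2\\-a+b/2&a+b/2&-\omega\end{pmatrix}$ ($a,b\in\mathbb R^n$, $\omega^t=-\omega$), let $\xi_F=\big(b^A+\nu y^A+(a\cdot y)y^A-\tfrac12|y|^2a^A-\omega^A{}_By^B\big)\partial_{y^A}$ be the associated conformal Killing vector field (CKVF) of $\mathbb E^n$. Write $\mathcal Z(X)$ for the zero set of a vector field $X$. **Even dimension $n=2p+2\ge4$.** Denote the Cartesian coordinates by $z_1,z_2,x_i,y_i$ ($1\le i\le p$). Let $\xi_F=\widetilde\xi+\sum_i\mu_i\eta_i$ be in canonical form: $\eta_i=x_i\partial_{y_i}-y_i\partial_{x_i}$, $\widetilde\xi$ has $a=(1,0,\dots,0)$, $b=(\sigma/2,\tau/2,0,\dots,0)$, $\nu=0$, $\omega=0$, with $\sigma\in\mathbb R$, $\tau\ge0$, $\mu_1\ge\dots\ge\mu_p\ge0$ and, for $\mu_s=\sqrt{(\sigma+\rho)/2}$, $\mu_t=\sqrt{(-\sigma+\rho)/2}$,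 $\rho=\sqrt{\sigma^2+\tau^2}$: $\mu_s=\mu_t=0$ if $\ker F$ is degenerate, and $\mu_s^2\ge\mu_i^2$ for all $i$ otherwise. Let $\widetilde\xi^\star$ be the CKVF with $a=(0,-1,0,\dots,0)$, $b=(-\tau/2,\sigma/2,0,\dots,0)$, $\nu=0$, $\omega=0$ (the Hodge dual of $\widetilde\xi$). Put $$U=\frac{\sqrt{\alpha^2+\mu_t^2+\mu_s^2}\,\cosh(\mu_tt_1+\mu_st_2)-\alpha\cos(\mu_tt_2-\mu_st_1)}{\mu_t^2+\mu_s^2}\quad\text{if }(\mu_s,\mu_t)\ne(0,0).$$ For fixed $t_1,t_2$ and $\alpha>0$ this expression tends to $\frac\alpha2(t_1^2+t_2^2)+\frac1{2\alpha}$ as $(\mu_s,\mu_t)\to(0,0)$, and $U$ denotes this limit if $\mu_s=\mu_t=0$. Then $U>0$ for $\alpha>0$, and $$z_1=-\frac1U\frac{\partial U}{\partial t_1},\quad z_2=\frac1U\frac{\partial U}{\partial t_2},\quad x_i=\frac{\alpha_i}U\cos\phi_i,\quad y_i=\frac{\alpha_i}U\sin\phi_i,\qquad\sum_i\alpha_i^2=1,\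 \alpha>0,\ \alpha_i>0,$$ define smooth local coordinates $(t_1,t_2,\alpha,\alpha_i,\phi_i)$, i.e. the map $(t_1,t_2,\alpha,\alpha_i,\phi_i)\mapsto(z_1,z_2,x_i,y_i)$ is a local diffeomorphism at every point with $t_1,t_2,\phi_i\in\mathbb R$, in which $\widetilde\xi=\partial_{t_1}$, $\widetilde\xi^\star=\partial_{t_2}$, $\eta_i=\partial_{\phi_i}$ and the flat metric is $$g_E=\frac1{U^2}\Big((\alpha^2+\mu_t^2)dt_1^2+(\alpha^2+\mu_s^2)dt_2^2+2\mu_s\mu_t\,dt_1dt_2+\frac{d\alpha^2}{\alpha^2+\mu_s^2+\mu_t^2}+\sum_{i=1}^p(d\alpha_i^2+\alpha_i^2d\phi_i^2)\Big|_{\sum\alpha_i^2=1}\Big).$$ Restricted to $-\pi\le\mu_tt_2-\mu_st_1<\pi$, $\phi_i\in[-\pi,\pi)$, $\alpha>0$, $\alpha_i>0$, $\sum\alpha_i^2=1$, this map is a bijection onto $\mathbb E^n\setminus\big(\bigcup_j\mathcal Z(\eta_j)\cup\mathcal Z(\mu_s\widetilde\xi-\mu_t\widetilde\xi^\star)\big)$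 if $(\mu_s,\mu_t)\neq(0,0)$, and onto $\mathbb E^n\setminus\bigcup_j\mathcal Z(\eta_j)$ if $\mu_s=\mu_t=0$. This region is the maximal possible one: it is exactly the set of points where $\widetilde\xi,\widetilde\xi^\star,\eta_1,\dots,\eta_p$ are linearly independent. **Odd dimension $n=2p+1\ge3$.** Denote the Cartesian coordinates by $z_1,x_i,y_i$. Let $\xi_F=\widetilde\xi+\sum_i\mu_i\eta_i$ be in canonical form: $\eta_i$ as above, $\widetilde\xi$ has $a=(1,0,\dots,0)$, $b=(\sigma/2,0,\dots,0)$, $\nu=0$, $\omega=0$, $\mu_1\ge\dots\ge\mu_p\ge0$, with $\sigma\ge\mu_i^2$ for all $i$ if $\ker F$ is timelike and $\sigma\le0$ otherwise. Then the formulas of dimension $n+1$ with $\tau=0$, restricted to $t_2=0$, take values in $\{z_2=0\}=\mathbb E^n$ and define smooth local coordinates $(t_1,\alpha,\alpha_i,\phi_i)$ of $\mathbb E^n$ in which $\widetilde\xi=\partial_{t_1}$ and $\eta_i=\partial_{\phi_i}$. Here $t_1,\phi_i\in\mathbb R$, $\alpha_i>0$, $\sum\alpha_i^2=1$, and $\alpha\in(0,\infty)$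 if $\sigma\ge0$, $\alpha\in\mathbb R$ if $\sigma<0$. The metric $g_E$ is the pull-back of the metric above to $t_2=0$ with $\tau=0$; explicitly, with $\epsilon=\operatorname{sign}\sigma$, $$g_E=\frac1{(U^\epsilon)^2}\Big(\big(\alpha^2+\tfrac{(1-\epsilon)|\sigma|}2\big)dt_1^2+\frac{d\alpha^2}{\alpha^2+|\sigma|}+\sum_{i=1}^p(d\alpha_i^2+\alpha_i^2d\phi_i^2)\Big|_{\sum\alpha_i^2=1}\Big),$$ where the restriction of $U$ is $U^+=\frac1\sigma\big(\sqrt{\alpha^2+\sigma}-\alpha\cos(\sqrt\sigma t_1)\big)$, $U^-=\frac1{-\sigma}\big(\sqrt{\alpha^2-\sigma}\cosh(\sqrt{-\sigma}t_1)-\alpha\big)$, $U^0=\frac12(\alpha t_1^2+\frac1\alpha)$ for $\sigma>0$, $\sigma<0$, $\sigma=0$ respectively (and is positive). For $t_1\in\mathbb R$, $\phi_i\in[-\pi,\pi)$ and $\alpha,\alpha_i$ as above, the coordinates cover exactly $\mathbb E^n\setminus\big(\bigcup_j\mathcal Z(\eta_j)\cup\mathcal Z(\widetilde\xi)\big)$;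 they do so in a one-to-one way if moreover $-\pi\le-\sqrt\sigma\,t_1<\pi$ in the case $\sigma>0$. This region is the maximal possible one: it is exactly the set of points where $\widetilde\xi,\eta_1,\dots,\eta_p$ are linearly independent. -/

import Mathlib

open Set Filter Topology
open scoped ContDiff

namespace AdaptedCoordinates

noncomputable section

/-! ### Skew-symmetric endomorphisms of Minkowski space and conformal Killing fields

`ι` is the index set of the Cartesian coordinates of the Euclidean space `EuclideanSpace ℝ ι`.
Minkowski space of dimension `|ι| + 2` has the index set `Fin 2 ⊕ ι`, where `Sum.inl 0` is the
timelike direction. -/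

section General

variable {ι : Type} [Fintype ι]

/-- The Minkowski scalar product of signature `(-, +, …, +)`. -/
def mink (v w : Fin 2 ⊕ ι → ℝ) : ℝ :=
  -(v (Sum.inl 0) * w (Sum.inl 0)) + v (Sum.inl 1) * w (Sum.inl 1)
    + ∑ A : ι, v (Sum.inr A) * w (Sum.inr A)

/-- `F` is skew-symmetric with respect to the Minkowski scalar product. -/
def IsSkew (F : Matrix (Fin 2 ⊕ ι) (Fin 2 ⊕ ι) ℝ) : Prop :=
  ∀ v w, mink (F.mulVec v) w = -mink v (F.mulVec w)

/-- The restriction of the Minkowski product to `ker F` is degenerate. -/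
def KerDegenerate (F : Matrix (Fin 2 ⊕ ι) (Fin 2 ⊕ ι) ℝ) : Prop :=
  ∃ v, v ≠ 0 ∧ F.mulVec v = 0 ∧ ∀ w, F.mulVec w = 0 → mink v w = 0

/-- `ker F` is timelike: it contains a timelike vector. -/
def KerTimelike (F : Matrix (Fin 2 ⊕ ι) (Fin 2 ⊕ ι) ℝ) : Prop :=
  ∃ v, F.mulVec v = 0 ∧ mink v v < 0

/-- The conformal Killing vector field of Euclidean space with parameters `ν, a, b, W`:
`ξ^A = b^A + ν y^A + (a·y) y^A - (1/2) (y·y) a^A - W^A_B y^B`, with `W` skew-symmetric. -/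
def ckvfOfParams (ν : ℝ) (a b : ι → ℝ) (W : Matrix ι ι ℝ) (y : EuclideanSpace ℝ ι) :
    EuclideanSpace ℝ ι :=
  WithLp.toLp 2 fun A =>
    b A + ν * y A + (∑ B, a B * y B) * y A - (1 / 2) * (∑ B, y B ^ 2) * a A - ∑ B, W A B * y B

/-! The parameters of `F = [[0, -ν, -aᵗ + bᵗ/2], [-ν, 0, -aᵗ - bᵗ/2], [-a + b/2, a + b/2, -W]]`. -/

def paramNu (F : Matrix (Fin 2 ⊕ ι) (Fin 2 ⊕ ι) ℝ) : ℝ := -F (Sum.inl 0) (Sum.inl 1)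

def paramA (F : Matrix (Fin 2 ⊕ ι) (Fin 2 ⊕ ι) ℝ) (A : ι) : ℝ :=
  -(1 / 2) * (F (Sum.inl 0) (Sum.inr A) + F (Sum.inl 1) (Sum.inr A))

def paramB (F : Matrix (Fin 2 ⊕ ι) (Fin 2 ⊕ ι) ℝ) (A : ι) : ℝ :=
  F (Sum.inl 0) (Sum.inr A) - F (Sum.inl 1) (Sum.inr A)

def paramOmega (F : Matrix (Fin 2 ⊕ ι) (Fin 2 ⊕ ι) ℝ) : Matrix ι ι ℝ :=
  Matrix.of fun A B => -F (Sum.inr A) (Sum.inr B)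

/-- The conformal Killing vector field `ξ_F` of Euclidean space associated with `F`. -/
def ckvf (F : Matrix (Fin 2 ⊕ ι) (Fin 2 ⊕ ι) ℝ) : EuclideanSpace ℝ ι → EuclideanSpace ℝ ι :=
  ckvfOfParams (paramNu F) (paramA F) (paramB F) (paramOmega F)

/-- The zero set of a vector field. -/
def zeroSet (X : EuclideanSpace ℝ ι → EuclideanSpace ℝ ι) : Set (EuclideanSpace ℝ ι) :=
  {y | X y = 0}

end General

/-- The rotation `[[0, -1], [1, 0]]` of the `i`-th spacelike coordinate plane, extended by zero. -/
def planeBlock {k p : ℕ} (i : Fin p) :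
    Matrix (Fin 2 ⊕ (Fin k ⊕ Fin p × Fin 2)) (Fin 2 ⊕ (Fin k ⊕ Fin p × Fin 2)) ℝ :=
  Matrix.single (Sum.inr (Sum.inr (i, 0))) (Sum.inr (Sum.inr (i, 1))) (-1)
    + Matrix.single (Sum.inr (Sum.inr (i, 1))) (Sum.inr (Sum.inr (i, 0))) 1

/-- The axial field `η_i = x_i ∂_{y_i} - y_i ∂_{x_i}`. -/
def eta {k p : ℕ} (i : Fin p) :
    EuclideanSpace ℝ (Fin k ⊕ Fin p × Fin 2) → EuclideanSpace ℝ (Fin k ⊕ Fin p × Fin 2) :=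
  ckvf (planeBlock i)

/-! ### Even dimension `n = 2 p + 2`

Cartesian coordinates: `z₁, z₂` have the indices `Sum.inl 0, Sum.inl 1`, and `x_i, y_i` have
the indices `Sum.inr (i, 0), Sum.inr (i, 1)`. -/

abbrev EvenSpace (p : ℕ) : Type := EuclideanSpace ℝ (Fin 2 ⊕ Fin p × Fin 2)

def muT (σ τ : ℝ) : ℝ := √((-σ + √(σ ^ 2 + τ ^ 2)) / 2)

def muS (σ τ : ℝ) : ℝ := √((σ + √(σ ^ 2 + τ ^ 2)) / 2)

/-- The canonical `4 × 4` block `F_{στ}`, extended by zero. -/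
def coreEven (p : ℕ) (σ τ : ℝ) :
    Matrix (Fin 2 ⊕ (Fin 2 ⊕ Fin p × Fin 2)) (Fin 2 ⊕ (Fin 2 ⊕ Fin p × Fin 2)) ℝ :=
  Matrix.fromBlocks 0
    (Matrix.fromCols !![-1 + σ / 4, τ / 4; -1 - σ / 4, -(τ / 4)] 0)
    (Matrix.fromRows !![-1 + σ / 4, 1 + σ / 4; τ / 4, τ / 4] 0) 0

/-- `F` is in canonical form with parameters `σ, τ, μ₁ ≥ … ≥ μ_p ≥ 0`. The roots of the square
root of the characteristic polynomial of `-F²` are `-μ_t², μ_s², μ₁², …, μ_p²`; they are sorted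
according to the causal character of `ker F`. -/
structure IsCanonicalEven {p : ℕ}
    (F : Matrix (Fin 2 ⊕ (Fin 2 ⊕ Fin p × Fin 2)) (Fin 2 ⊕ (Fin 2 ⊕ Fin p × Fin 2)) ℝ)
    (σ τ : ℝ) (μ : Fin p → ℝ) : Prop where
  skew : IsSkew F
  form : F = coreEven p σ τ + ∑ i, μ i • planeBlock i
  tau_nonneg : 0 ≤ τ
  mu_nonneg : ∀ i, 0 ≤ μ i
  mu_sorted : Antitone μ
  of_degenerate : KerDegenerate F → muS σ τ = 0 ∧ muT σ τ = 0
  of_not_degenerate : ¬ KerDegenerate F → ∀ i, μ i ^ 2 ≤ muS σ τ ^ 2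

/-- The field `ξ̃` of the canonical decomposition. -/
def xiEven {p : ℕ} (σ τ : ℝ) : EvenSpace p → EvenSpace p := ckvf (coreEven p σ τ)

/-- The field of the Hodge dual of an endomorphism of the `4`-dimensional Minkowski factor: the
parameters `(ν, a¹, a², b¹, b², W¹₂)` become `(-W¹₂, a², -a¹, -b², b¹, ν)`. -/
def ckvfStar {p : ℕ}
    (F : Matrix (Fin 2 ⊕ (Fin 2 ⊕ Fin p × Fin 2)) (Fin 2 ⊕ (Fin 2 ⊕ Fin p × Fin 2)) ℝ) :
    EvenSpace p → EvenSpace p :=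
  ckvfOfParams (-paramOmega F (Sum.inl 0) (Sum.inl 1))
    (Sum.elim ![paramA F (Sum.inl 1), -paramA F (Sum.inl 0)] 0)
    (Sum.elim ![-paramB F (Sum.inl 1), paramB F (Sum.inl 0)] 0)
    (Matrix.fromBlocks !![0, paramNu F; -paramNu F, 0] 0 0 0)

/-- The field `ξ̃⋆`. -/
def xiStarEven {p : ℕ} (σ τ : ℝ) : EvenSpace p → EvenSpace p := ckvfStar (coreEven p σ τ)

/-- The expression of the function `U` for `(μ_s, μ_t) ≠ (0, 0)`. -/
def UGeneric (ms mt t₁ t₂ α : ℝ) : ℝ :=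
  (√(α ^ 2 + mt ^ 2 + ms ^ 2) * Real.cosh (mt * t₁ + ms * t₂)
    - α * Real.cos (mt * t₂ - ms * t₁)) / (mt ^ 2 + ms ^ 2)

/-- The limit of `U` as `μ_s, μ_t → 0`. -/
def ULimit (t₁ t₂ α : ℝ) : ℝ := α / 2 * (t₁ ^ 2 + t₂ ^ 2) + 1 / (2 * α)

open Classical in
/-- The function `U`, understood as its limit when `μ_s = μ_t = 0`. -/
def U (ms mt t₁ t₂ α : ℝ) : ℝ :=
  if ms = 0 ∧ mt = 0 then ULimit t₁ t₂ α else UGeneric ms mt t₁ t₂ α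

/-- The point of Euclidean space with adapted coordinates `t₁, t₂, α, α_i, φ_i`. -/
def evenChart {p : ℕ} (ms mt t₁ t₂ α : ℝ) (a φ : Fin p → ℝ) : EvenSpace p :=
  WithLp.toLp 2 (Sum.elim
    ![-(1 / U ms mt t₁ t₂ α) * deriv (fun s => U ms mt s t₂ α) t₁,
      (1 / U ms mt t₁ t₂ α) * deriv (fun s => U ms mt t₁ s α) t₂]
    (fun k => ![a k.1 / U ms mt t₁ t₂ α * Real.cos (φ k.1),
                a k.1 / U ms mt t₁ t₂ α * Real.sin (φ k.1)] k.2))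

/-- Values of `(t₁, t₂, α, (α_i), (φ_i))`; also used for coordinate components of tangent
vectors. -/
abbrev EvenParam (p : ℕ) : Type := ℝ × ℝ × ℝ × (Fin p → ℝ) × (Fin p → ℝ)

/-- `evenChart` as a function of the tuple of all coordinates (with the `α_i` unconstrained). -/
def evenMap {p : ℕ} (ms mt : ℝ) (q : EvenParam p) : EvenSpace p :=
  evenChart ms mt q.1 q.2.1 q.2.2.1 q.2.2.2.1 q.2.2.2.2

/-- The constraint `∑ α_i² = 1`. -/
def evenConstraint (p : ℕ) : Set (EvenParam p) := {q | ∑ i, q.2.2.2.1 i ^ 2 = 1}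

/-- The band `B(μ_s, μ_t)`; it is the whole plane when `μ_s = μ_t = 0`. -/
def band (ms mt : ℝ) : Set (ℝ × ℝ) :=
  {t | -Real.pi ≤ mt * t.2 - ms * t.1 ∧ mt * t.2 - ms * t.1 < Real.pi}

/-- The range of the adapted coordinates. -/
def evenRange (p : ℕ) (ms mt : ℝ) : Set (EvenParam p) :=
  {q | (q.1, q.2.1) ∈ band ms mt ∧ 0 < q.2.2.1 ∧ (∀ i, 0 < q.2.2.2.1 i) ∧
    q ∈ evenConstraint p ∧ ∀ i, q.2.2.2.2 i ∈ Ico (-Real.pi) Real.pi}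

open Classical in
/-- The complement of the zero sets of the `η_j` and, if `(μ_s, μ_t) ≠ (0, 0)`, of
`μ_s ξ̃ - μ_t ξ̃⋆`. -/
def evenDomain (p : ℕ) (σ τ : ℝ) : Set (EvenSpace p) :=
  ((⋃ j : Fin p, zeroSet (eta j)) ∪
    (if muS σ τ = 0 ∧ muT σ τ = 0 then ∅
      else zeroSet fun y => muS σ τ • xiEven σ τ y - muT σ τ • xiStarEven σ τ y))ᶜ

/-- The quadratic form `∑ (dα_i² + α_i² dφ_i²)`, to be evaluated on `∑ α_i dα_i = 0`. -/
def sphereForm {p : ℕ} (a da dφ : Fin p → ℝ) : ℝ := ∑ i, (da i ^ 2 + a i ^ 2 * dφ i ^ 2)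

/-- The quadratic form of the flat metric in adapted coordinates, even dimension. -/
def evenMetric {p : ℕ} (ms mt t₁ t₂ α : ℝ) (a : Fin p → ℝ) (v : EvenParam p) : ℝ :=
  1 / U ms mt t₁ t₂ α ^ 2 *
    ((α ^ 2 + mt ^ 2) * v.1 ^ 2 + (α ^ 2 + ms ^ 2) * v.2.1 ^ 2 + 2 * ms * mt * v.1 * v.2.1
      + v.2.2.1 ^ 2 / (α ^ 2 + ms ^ 2 + mt ^ 2) + sphereForm a v.2.2.2.1 v.2.2.2.2)

/-- `Φ`, restricted to the submanifold `M` of parameters, is near `q` a smooth parametrization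
with a smooth local inverse, i.e. the parameters in `M` are local coordinates around `Φ q`. -/
def IsLocalCoordinatesAt {P E : Type} [NormedAddCommGroup P] [NormedSpace ℝ P]
    [NormedAddCommGroup E] [NormedSpace ℝ E] (M : Set P) (Φ : P → E) (q : P) : Prop :=
  ContDiffAt ℝ ∞ Φ q ∧ ∃ g : E → P, ContDiffAt ℝ ∞ g (Φ q) ∧
    (∀ᶠ y in 𝓝 (Φ q), g y ∈ M ∧ Φ (g y) = y) ∧ ∀ᶠ q' in 𝓝[M] q, g (Φ q') = q'

/-! ### Odd dimension `n = 2 p + 1`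

Cartesian coordinates: `z₁` has the index `Sum.inl 0`, and `x_i, y_i` have the indices
`Sum.inr (i, 0), Sum.inr (i, 1)`. -/

abbrev OddSpace (p : ℕ) : Type := EuclideanSpace ℝ (Fin 1 ⊕ Fin p × Fin 2)

/-- The canonical `3 × 3` block `F_σ`, extended by zero. -/
def coreOdd (p : ℕ) (σ : ℝ) :
    Matrix (Fin 2 ⊕ (Fin 1 ⊕ Fin p × Fin 2)) (Fin 2 ⊕ (Fin 1 ⊕ Fin p × Fin 2)) ℝ :=
  Matrix.fromBlocks 0
    (Matrix.fromCols !![-1 + σ / 4; -1 - σ / 4] 0)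
    (Matrix.fromRows !![-1 + σ / 4, 1 + σ / 4] 0) 0

/-- `F` is in canonical form with parameters `σ, μ₁ ≥ … ≥ μ_p ≥ 0`, which are sorted according to
the causal character of `ker F`. -/
structure IsCanonicalOdd {p : ℕ}
    (F : Matrix (Fin 2 ⊕ (Fin 1 ⊕ Fin p × Fin 2)) (Fin 2 ⊕ (Fin 1 ⊕ Fin p × Fin 2)) ℝ)
    (σ : ℝ) (μ : Fin p → ℝ) : Prop where
  skew : IsSkew F
  form : F = coreOdd p σ + ∑ i, μ i • planeBlock i
  mu_nonneg : ∀ i, 0 ≤ μ i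
  mu_sorted : Antitone μ
  of_timelike : KerTimelike F → ∀ i, μ i ^ 2 ≤ σ
  of_not_timelike : ¬ KerTimelike F → σ ≤ 0

/-- The field `ξ̃` of the canonical decomposition. -/
def xiOdd {p : ℕ} (σ : ℝ) : OddSpace p → OddSpace p := ckvf (coreOdd p σ)

/-- The embedding onto the hyperplane `{z₂ = 0}`. -/
def hyperplane {p : ℕ} (y : OddSpace p) : EvenSpace p :=
  WithLp.toLp 2 (Sum.elim ![y (Sum.inl 0), 0] fun k => y (Sum.inr k))

/-- The coordinates `z₁, x_i, y_i` of the even-dimensional parametrization for `τ = 0` at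
`t₂ = 0`. -/
def oddChart {p : ℕ} (σ t₁ α : ℝ) (a φ : Fin p → ℝ) : OddSpace p :=
  WithLp.toLp 2 (Sum.elim
    (fun _ => evenChart (muS σ 0) (muT σ 0) t₁ 0 α a φ (Sum.inl 0))
    (fun k => evenChart (muS σ 0) (muT σ 0) t₁ 0 α a φ (Sum.inr k)))

/-- Values of `(t₁, α, (α_i), (φ_i))`. -/
abbrev OddParam (p : ℕ) : Type := ℝ × ℝ × (Fin p → ℝ) × (Fin p → ℝ)

def oddMap {p : ℕ} (σ : ℝ) (q : OddParam p) : OddSpace p :=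
  oddChart σ q.1 q.2.1 q.2.2.1 q.2.2.2

def oddConstraint (p : ℕ) : Set (OddParam p) := {q | ∑ i, q.2.2.1 i ^ 2 = 1}

open Classical in
/-- The range of `α`: the positive numbers if `σ ≥ 0`, all real numbers if `σ < 0`. -/
def alphaRange (σ : ℝ) : Set ℝ := if σ < 0 then univ else Ioi 0

/-- The range of the adapted coordinates, with `t₁ ∈ ℝ`. -/
def oddRange (p : ℕ) (σ : ℝ) : Set (OddParam p) :=
  {q | q.2.1 ∈ alphaRange σ ∧ (∀ i, 0 < q.2.2.1 i) ∧
    q ∈ oddConstraint p ∧ ∀ i, q.2.2.2 i ∈ Ico (-Real.pi) Real.pi}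

/-- The complement of the zero sets of the `η_j` and of `ξ̃`. -/
def oddDomain (p : ℕ) (σ : ℝ) : Set (OddSpace p) :=
  ((⋃ j : Fin p, zeroSet (eta j)) ∪ zeroSet (xiOdd σ))ᶜ

open Classical in
/-- The functions `U⁺, U⁻, U⁰` according to the sign of `σ`. -/
def UOdd (σ t₁ α : ℝ) : ℝ :=
  if 0 < σ then 1 / σ * (√(α ^ 2 + σ) - α * Real.cos (√σ * t₁))
  else if σ < 0 then 1 / (-σ) * (√(α ^ 2 - σ) * Real.cosh (√(-σ) * t₁) - α)
  else 1 / 2 * (α * t₁ ^ 2 + 1 / α)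

/-- The explicit flat metric in adapted coordinates, odd dimension. -/
def oddMetric {p : ℕ} (σ t₁ α : ℝ) (a : Fin p → ℝ) (v : OddParam p) : ℝ :=
  1 / UOdd σ t₁ α ^ 2 *
    ((α ^ 2 + (1 - Real.sign σ) * |σ| / 2) * v.1 ^ 2 + v.2.1 ^ 2 / (α ^ 2 + |σ|)
      + sphereForm a v.2.2.1 v.2.2.2)

end

end AdaptedCoordinates

open AdaptedCoordinates

/-! Put r = `√(axialSq y)`. Off the axis r = 0 the flat metric is r² times the product of the
hyperbolic metric (dz₁² + dz₂² + dr²)/r² on H³ and the round metric on the sphere of the `α_i, φ_i`.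
The substitution r = 1/u, z₁ = -u₁/u, z₂ = u₂/u (`assemble`) identifies this half-space with the
hyperboloid u v - u₁² - u₂² = 1, u > 0, whose metric is du₁² + du₂² - du dv
(`metric_identity_of_null`). It remains to see that u = `U`, u₁ = ∂₁U, u₂ = ∂₂U, v = `companion`
parametrizes this hyperboloid (`U_mul_companion`).

Write N = μ_t² + μ_s², β = √(α² + N), A = μ_t t₁ + μ_s t₂, B = μ_t t₂ - μ_s t₁. If N ≠ 0, the
quantities β cosh A, β sinh A, α cos B, α sin B are linear functions of (u, v, u₁, u₂), so (A, B, α)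
are cylindrical coordinates around a geodesic of H³. The field μ_s ξ̃ - μ_t ξ̃⋆ is the rotation
about that geodesic, with B changing at rate -N, and its zeros off the axis r = 0 are the locus α =
0. Hence the bijectivity: polar coordinates recover (α, B), injectivity of sinh recovers A, and (A,
B) determines (t₁, t₂) linearly with determinant N (`exists_coordinates`, `coordinates_unique`). If
N = 0 the two fields act parabolically, v = 2α and t_i = u_i/α.

The Hessian of `U` in (t₁, t₂) is a linear combination of `U` and `companion`; this closed system
turns ∂_{t₁}, ∂_{t₂} into ξ̃, ξ̃⋆ (`hasDerivAt_evenChart_one`, `hasDerivAt_evenChart_two`).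
Positivity of the metric gives the local diffeomorphism through the inverse function theorem
(`isLocalCoordinatesAt_of_injective`), and maximality is a 2 × 2 determinant computation
(`evenDomain_eq`).

The odd case is the slice t₂ = 0, where ∂₂U = 0 because τ = 0 forces μ_s μ_t = 0. For σ > 0 the
slice is a hyperbolic plane orthogonal to the geodesic, with (α, B) polar coordinates, so α > 0. For
σ < 0 it is a plane containing the geodesic, with B = 0 and α a signed distance parameter, so α
ranges over ℝ. -/

namespace AdaptedCoordinates

noncomputable section

/-! ### Linearity of F ↦ ξ_F and components of the fields -/

section Fields

variable {ι : Type} [Fintype ι]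

lemma ckvf_add (F G : Matrix (Fin 2 ⊕ ι) (Fin 2 ⊕ ι) ℝ) (y : EuclideanSpace ℝ ι) :
    ckvf (F + G) y = ckvf F y + ckvf G y := by
  ext A
  simp only [ckvf, ckvfOfParams, paramNu, paramA, paramB, paramOmega, Matrix.add_apply,
    PiLp.add_apply, Matrix.of_apply, neg_add, mul_add, add_mul, Finset.sum_add_distrib]
  ring

lemma ckvf_smul (c : ℝ) (F : Matrix (Fin 2 ⊕ ι) (Fin 2 ⊕ ι) ℝ) (y : EuclideanSpace ℝ ι) :
    ckvf (c • F) y = c • ckvf F y := by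
  ext A
  have h1 : ∑ B, -(1 / 2) * (c * F (Sum.inl 0) (Sum.inr B) + c * F (Sum.inl 1) (Sum.inr B)) * y B
      = c * ∑ B, -(1 / 2) * (F (Sum.inl 0) (Sum.inr B) + F (Sum.inl 1) (Sum.inr B)) * y B := by
    rw [Finset.mul_sum]
    exact Finset.sum_congr rfl fun B _ => by ring
  have h2 : ∑ B, -(c * F (Sum.inr A) (Sum.inr B)) * y B
      = c * ∑ B, -F (Sum.inr A) (Sum.inr B) * y B := by
    rw [Finset.mul_sum]
    exact Finset.sum_congr rfl fun B _ => by ring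
  simp only [ckvf, ckvfOfParams, paramNu, paramA, paramB, paramOmega, Matrix.smul_apply,
    PiLp.smul_apply, Matrix.of_apply, smul_eq_mul, h1, h2]
  ring

lemma ckvf_zero (y : EuclideanSpace ℝ ι) :
    ckvf (0 : Matrix (Fin 2 ⊕ ι) (Fin 2 ⊕ ι) ℝ) y = 0 := by
  simpa using ckvf_smul 0 (0 : Matrix (Fin 2 ⊕ ι) (Fin 2 ⊕ ι) ℝ) y

lemma ckvf_sum {κ : Type} (s : Finset κ) (F : κ → Matrix (Fin 2 ⊕ ι) (Fin 2 ⊕ ι) ℝ)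
    (y : EuclideanSpace ℝ ι) : ckvf (∑ i ∈ s, F i) y = ∑ i ∈ s, ckvf (F i) y := by
  classical
  induction s using Finset.induction_on with
  | empty => simp [ckvf_zero]
  | insert i s hi ih => rw [Finset.sum_insert hi, Finset.sum_insert hi, ckvf_add, ih]

end Fields

lemma ckvf_canonical {k p : ℕ}
    (G : Matrix (Fin 2 ⊕ (Fin k ⊕ Fin p × Fin 2)) (Fin 2 ⊕ (Fin k ⊕ Fin p × Fin 2)) ℝ)
    (μ : Fin p → ℝ) (y : EuclideanSpace ℝ (Fin k ⊕ Fin p × Fin 2)) :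
    ckvf (G + ∑ i, μ i • planeBlock i) y = ckvf G y + ∑ i, μ i • eta i y := by
  rw [ckvf_add, ckvf_sum]
  simp_rw [ckvf_smul]
  rfl

section Eta

variable {k p : ℕ} (i : Fin p) (y : EuclideanSpace ℝ (Fin k ⊕ Fin p × Fin 2))

lemma eta_eq (A : Fin k ⊕ Fin p × Fin 2) :
    eta i y A = -∑ B, paramOmega (planeBlock i) A B * y B := by
  simp [eta, ckvf, ckvfOfParams, paramNu, paramA, paramB, planeBlock]

@[simp] lemma eta_inl (j : Fin k) : eta i y (Sum.inl j) = 0 := by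
  simp [eta_eq, paramOmega, planeBlock, Matrix.single_apply]

@[simp] lemma eta_inr_zero (j : Fin p) :
    eta i y (Sum.inr (j, 0)) = if j = i then -y (Sum.inr (i, 1)) else 0 := by
  simp only [eta_eq, paramOmega, planeBlock, Matrix.single_apply, Matrix.add_apply,
    Matrix.of_apply, Fintype.sum_sum_type, Fintype.sum_prod_type, Fin.sum_univ_two]
  by_cases h : i = j
  · subst h
    simp
  · simp [h, Ne.symm h]

@[simp] lemma eta_inr_one (j : Fin p) :
    eta i y (Sum.inr (j, 1)) = if j = i then y (Sum.inr (i, 0)) else 0 := by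
  simp only [eta_eq, paramOmega, planeBlock, Matrix.single_apply, Matrix.add_apply,
    Matrix.of_apply, Fintype.sum_sum_type, Fintype.sum_prod_type, Fin.sum_univ_two]
  by_cases h : i = j
  · subst h
    simp
  · simp [h, Ne.symm h]

end Eta

/-- The square of the distance to the common axis of the axial fields. -/
def axialSq {k p : ℕ} (y : EuclideanSpace ℝ (Fin k ⊕ Fin p × Fin 2)) : ℝ :=
  ∑ i : Fin p, (y (Sum.inr (i, 0)) ^ 2 + y (Sum.inr (i, 1)) ^ 2)

lemma eta_eq_zero_iff {k p : ℕ} (i : Fin p) (y : EuclideanSpace ℝ (Fin k ⊕ Fin p × Fin 2)) :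
    eta i y = 0 ↔ y (Sum.inr (i, 0)) = 0 ∧ y (Sum.inr (i, 1)) = 0 := by
  constructor
  · intro h
    have h0 := congrArg (fun w => w (Sum.inr (i, 0))) h
    have h1 := congrArg (fun w => w (Sum.inr (i, 1))) h
    simp at h0 h1
    exact ⟨h1, h0⟩
  · rintro ⟨h0, h1⟩
    ext A
    rcases A with j | ⟨j, c⟩
    · simp
    · fin_cases c <;> simp [h0, h1]

section Even

variable {p : ℕ} (σ τ : ℝ) (y : EvenSpace p)

@[simp] lemma xiEven_inl_zero : xiEven σ τ y (Sum.inl 0)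
    = (σ + y (Sum.inl 0) ^ 2 - y (Sum.inl 1) ^ 2 - axialSq y) / 2 := by
  simp [xiEven, ckvf, ckvfOfParams, paramNu, paramA, paramB, paramOmega, coreEven, axialSq,
    Fintype.sum_prod_type]
  ring

@[simp] lemma xiEven_inl_one : xiEven σ τ y (Sum.inl 1)
    = τ / 2 + y (Sum.inl 0) * y (Sum.inl 1) := by
  simp [xiEven, ckvf, ckvfOfParams, paramNu, paramA, paramB, paramOmega, coreEven]
  ring

@[simp] lemma xiEven_inr (k : Fin p × Fin 2) : xiEven σ τ y (Sum.inr k)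
    = y (Sum.inl 0) * y (Sum.inr k) := by
  simp [xiEven, ckvf, ckvfOfParams, paramNu, paramA, paramB, paramOmega, coreEven]
  ring

@[simp] lemma xiStarEven_inl_zero : xiStarEven σ τ y (Sum.inl 0)
    = -(τ / 2) - y (Sum.inl 0) * y (Sum.inl 1) := by
  simp [xiStarEven, ckvfStar, ckvfOfParams, paramNu, paramA, paramB, paramOmega, coreEven]
  ring

@[simp] lemma xiStarEven_inl_one : xiStarEven σ τ y (Sum.inl 1)
    = (σ + y (Sum.inl 0) ^ 2 - y (Sum.inl 1) ^ 2 + axialSq y) / 2 := by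
  simp [xiStarEven, ckvfStar, ckvfOfParams, paramNu, paramA, paramB, paramOmega, coreEven, axialSq,
    Fintype.sum_prod_type]
  ring

@[simp] lemma xiStarEven_inr (k : Fin p × Fin 2) : xiStarEven σ τ y (Sum.inr k)
    = -(y (Sum.inl 1) * y (Sum.inr k)) := by
  simp [xiStarEven, ckvfStar, ckvfOfParams, paramNu, paramA, paramB, paramOmega, coreEven]
  ring

end Even

section Odd

variable {p : ℕ} (σ : ℝ) (y : OddSpace p)

@[simp] lemma xiOdd_inl (j : Fin 1) : xiOdd σ y (Sum.inl j)
    = (σ + y (Sum.inl 0) ^ 2 - axialSq y) / 2 := by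
  obtain rfl : j = 0 := Subsingleton.elim _ _
  simp [xiOdd, ckvf, ckvfOfParams, paramNu, paramA, paramB, paramOmega, coreOdd, axialSq,
    Fintype.sum_prod_type]
  ring

@[simp] lemma xiOdd_inr (k : Fin p × Fin 2) : xiOdd σ y (Sum.inr k)
    = y (Sum.inl 0) * y (Sum.inr k) := by
  simp [xiOdd, ckvf, ckvfOfParams, paramNu, paramA, paramB, paramOmega, coreOdd]
  ring

@[simp] lemma hyperplane_inl_zero : hyperplane y (Sum.inl 0) = y (Sum.inl 0) := rfl

@[simp] lemma hyperplane_inl_one : hyperplane y (Sum.inl 1) = 0 := rfl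

@[simp] lemma hyperplane_inr (k : Fin p × Fin 2) :
    hyperplane y (Sum.inr k) = y (Sum.inr k) := rfl

end Odd

/-! ### Relations between μ_s, μ_t and σ, τ -/

section Parameters

variable (σ τ : ℝ)

lemma muS_nonneg : 0 ≤ muS σ τ := Real.sqrt_nonneg _

lemma muT_nonneg : 0 ≤ muT σ τ := Real.sqrt_nonneg _

lemma muS_sq : muS σ τ ^ 2 = (σ + √(σ ^ 2 + τ ^ 2)) / 2 := by
  have : |σ| ≤ √(σ ^ 2 + τ ^ 2) := Real.abs_le_sqrt (by nlinarith [sq_nonneg τ])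
  exact Real.sq_sqrt (by linarith [neg_abs_le σ])

lemma muT_sq : muT σ τ ^ 2 = (-σ + √(σ ^ 2 + τ ^ 2)) / 2 := by
  have : |σ| ≤ √(σ ^ 2 + τ ^ 2) := Real.abs_le_sqrt (by nlinarith [sq_nonneg τ])
  exact Real.sq_sqrt (by linarith [le_abs_self σ])

/-- Together with `two_mul_muS_mul_muT` this says (μ_s + i μ_t)² = σ + i τ. Most of the later lemmas
use only these two relations, with `ms`, `mt` arbitrary. -/
lemma muS_sq_sub_muT_sq : muS σ τ ^ 2 - muT σ τ ^ 2 = σ := by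
  rw [muS_sq, muT_sq]
  ring

lemma two_mul_muS_mul_muT (hτ : 0 ≤ τ) : 2 * muS σ τ * muT σ τ = τ := by
  have h := Real.sq_sqrt (show 0 ≤ σ ^ 2 + τ ^ 2 by positivity)
  -- Squares determine the product up to sign; τ ≥ 0 fixes the sign.
  have h2 : (2 * muS σ τ * muT σ τ) ^ 2 = τ ^ 2 := by
    rw [mul_pow, mul_pow, muS_sq, muT_sq]
    linear_combination h
  exact (sq_eq_sq₀ (by have := muS_nonneg σ τ; have := muT_nonneg σ τ; positivity) hτ).1 h2

variable {σ}

lemma muS_of_nonneg (h : 0 ≤ σ) : muS σ 0 = √σ := by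
  simp [muS, Real.sqrt_sq h]

lemma muT_of_nonneg (h : 0 ≤ σ) : muT σ 0 = 0 := by
  simp [muT, Real.sqrt_sq h]

lemma muS_of_nonpos (h : σ ≤ 0) : muS σ 0 = 0 := by
  simp [muS, Real.sqrt_sq_eq_abs, abs_of_nonpos h]

lemma muT_of_nonpos (h : σ ≤ 0) : muT σ 0 = √(-σ) := by
  simp [muT, Real.sqrt_sq_eq_abs, abs_of_nonpos h]

end Parameters

/-! ### Calculus of U, its partial derivatives and the companion function -/

/-- The derivative of `U` with respect to `t₁`. -/
def partialOne (ms mt t₁ t₂ α : ℝ) : ℝ :=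
  if ms = 0 ∧ mt = 0 then α * t₁ else
    (mt * (√(α ^ 2 + mt ^ 2 + ms ^ 2) * Real.sinh (mt * t₁ + ms * t₂))
      - ms * (α * Real.sin (mt * t₂ - ms * t₁))) / (mt ^ 2 + ms ^ 2)

/-- The derivative of `U` with respect to `t₂`. -/
def partialTwo (ms mt t₁ t₂ α : ℝ) : ℝ :=
  if ms = 0 ∧ mt = 0 then α * t₂ else
    (ms * (√(α ^ 2 + mt ^ 2 + ms ^ 2) * Real.sinh (mt * t₁ + ms * t₂))
      + mt * (α * Real.sin (mt * t₂ - ms * t₁))) / (mt ^ 2 + ms ^ 2)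

/-- The function `V` with `U V = 1 + (∂₁ U)² + (∂₂ U)²`. -/
def companion (ms mt t₁ t₂ α : ℝ) : ℝ :=
  if ms = 0 ∧ mt = 0 then 2 * α else
    √(α ^ 2 + mt ^ 2 + ms ^ 2) * Real.cosh (mt * t₁ + ms * t₂)
      + α * Real.cos (mt * t₂ - ms * t₁)

section Calculus

variable {ms mt : ℝ}

lemma sq_add_sq_pos (h : ¬(ms = 0 ∧ mt = 0)) : 0 < mt ^ 2 + ms ^ 2 := by
  rcases not_and_or.1 h with h | h <;> positivity

lemma radicand_pos (h : ¬(ms = 0 ∧ mt = 0)) (α : ℝ) : 0 < α ^ 2 + mt ^ 2 + ms ^ 2 := by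
  nlinarith [sq_add_sq_pos h, sq_nonneg α]

/-- In the generic case α cos B ≤ |α| < β ≤ β cosh A whatever the sign of α. Positivity of α is
required only in the limit case, so that the lemma also serves the odd dimension with σ < 0, where α
ranges over ℝ. -/
lemma U_pos {t₁ t₂ α : ℝ} (h : ms = 0 ∧ mt = 0 → 0 < α) : 0 < U ms mt t₁ t₂ α := by
  unfold U
  split_ifs with h0
  · have := h h0
    unfold ULimit
    positivity
  · have hN := sq_add_sq_pos h0
    refine div_pos (sub_pos.2 ?_) hN
    calc α * Real.cos (mt * t₂ - ms * t₁) ≤ |α * Real.cos (mt * t₂ - ms * t₁)| := le_abs_self _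
      _ ≤ |α| * 1 := by
        rw [abs_mul]
        exact mul_le_mul_of_nonneg_left (Real.abs_cos_le_one _) (abs_nonneg _)
      _ < √(α ^ 2 + mt ^ 2 + ms ^ 2) * 1 := by
        rw [mul_one, mul_one]
        exact Real.lt_sqrt_of_sq_lt (by rw [sq_abs]; linarith)
      _ ≤ _ := mul_le_mul_of_nonneg_left (Real.one_le_cosh _) (Real.sqrt_nonneg _)

lemma U_mul_companion {t₁ t₂ α : ℝ} (h : ms = 0 ∧ mt = 0 → 0 < α) :
    U ms mt t₁ t₂ α * companion ms mt t₁ t₂ α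
      = 1 + partialOne ms mt t₁ t₂ α ^ 2 + partialTwo ms mt t₁ t₂ α ^ 2 := by
  unfold U companion partialOne partialTwo
  split_ifs with h0
  · have := h h0
    unfold ULimit
    field_simp
    ring
  · have hN := sq_add_sq_pos h0
    have hβ := Real.sq_sqrt (radicand_pos h0 α).le
    have hC := Real.cosh_sq (mt * t₁ + ms * t₂)
    have hc := Real.cos_sq_add_sin_sq (mt * t₂ - ms * t₁)
    unfold UGeneric
    set β := √(α ^ 2 + mt ^ 2 + ms ^ 2)
    set c := Real.cos (mt * t₂ - ms * t₁)
    set n := Real.sin (mt * t₂ - ms * t₁)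
    field_simp
    linear_combination (mt ^ 2 + ms ^ 2) * β ^ 2 * hC + (mt ^ 2 + ms ^ 2) * hβ
      - (mt ^ 2 + ms ^ 2) * α ^ 2 * hc

section Curve

variable {x₁ x₂ x₃ : ℝ → ℝ} {d₁ d₂ d₃ e : ℝ}

/-- The quotient dα/β is kept as one factor: it is the arclength element of the α-direction, and the
metric computation later names it as a single variable. -/
lemma hasDerivAt_radius (h0 : ¬(ms = 0 ∧ mt = 0)) (h₃ : HasDerivAt x₃ d₃ e) :
    HasDerivAt (fun ε => √(x₃ ε ^ 2 + mt ^ 2 + ms ^ 2))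
      (x₃ e * (d₃ / √(x₃ e ^ 2 + mt ^ 2 + ms ^ 2))) e := by
  have h := (((h₃.pow 2).add_const (mt ^ 2)).add_const (ms ^ 2)).sqrt (radicand_pos h0 (x₃ e)).ne'
  refine h.congr_deriv ?_
  have := Real.sqrt_pos.2 (radicand_pos h0 (x₃ e))
  simp
  field_simp

lemma hasDerivAt_U_generic (h0 : ¬(ms = 0 ∧ mt = 0)) (h₁ : HasDerivAt x₁ d₁ e)
    (h₂ : HasDerivAt x₂ d₂ e) (h₃ : HasDerivAt x₃ d₃ e) :
    HasDerivAt (fun ε => U ms mt (x₁ ε) (x₂ ε) (x₃ ε))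
      ((x₃ e * (d₃ / √(x₃ e ^ 2 + mt ^ 2 + ms ^ 2)) * Real.cosh (mt * x₁ e + ms * x₂ e)
        + √(x₃ e ^ 2 + mt ^ 2 + ms ^ 2)
          * (Real.sinh (mt * x₁ e + ms * x₂ e) * (mt * d₁ + ms * d₂))
        - (d₃ * Real.cos (mt * x₂ e - ms * x₁ e)
          + x₃ e * (-Real.sin (mt * x₂ e - ms * x₁ e) * (mt * d₂ - ms * d₁))))
        / (mt ^ 2 + ms ^ 2)) e := by
  simp only [U, if_neg h0, UGeneric]
  exact (((hasDerivAt_radius h0 h₃).mul ((h₁.const_mul mt).add (h₂.const_mul ms)).cosh).sub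
    (h₃.mul ((h₂.const_mul mt).sub (h₁.const_mul ms)).cos)).div_const _

lemma hasDerivAt_sinh_part (h0 : ¬(ms = 0 ∧ mt = 0)) (h₁ : HasDerivAt x₁ d₁ e)
    (h₂ : HasDerivAt x₂ d₂ e) (h₃ : HasDerivAt x₃ d₃ e) :
    HasDerivAt (fun ε => √(x₃ ε ^ 2 + mt ^ 2 + ms ^ 2) * Real.sinh (mt * x₁ ε + ms * x₂ ε))
      (x₃ e * (d₃ / √(x₃ e ^ 2 + mt ^ 2 + ms ^ 2)) * Real.sinh (mt * x₁ e + ms * x₂ e)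
        + √(x₃ e ^ 2 + mt ^ 2 + ms ^ 2)
          * (Real.cosh (mt * x₁ e + ms * x₂ e) * (mt * d₁ + ms * d₂))) e :=
  (hasDerivAt_radius h0 h₃).mul ((h₁.const_mul mt).add (h₂.const_mul ms)).sinh

lemma hasDerivAt_sin_part (h₁ : HasDerivAt x₁ d₁ e)
    (h₂ : HasDerivAt x₂ d₂ e) (h₃ : HasDerivAt x₃ d₃ e) :
    HasDerivAt (fun ε => x₃ ε * Real.sin (mt * x₂ ε - ms * x₁ ε))
      (d₃ * Real.sin (mt * x₂ e - ms * x₁ e)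
          + x₃ e * (Real.cos (mt * x₂ e - ms * x₁ e) * (mt * d₂ - ms * d₁))) e :=
  h₃.mul ((h₂.const_mul mt).sub (h₁.const_mul ms)).sin

lemma hasDerivAt_partialOne_generic (h0 : ¬(ms = 0 ∧ mt = 0)) (h₁ : HasDerivAt x₁ d₁ e)
    (h₂ : HasDerivAt x₂ d₂ e) (h₃ : HasDerivAt x₃ d₃ e) :
    HasDerivAt (fun ε => partialOne ms mt (x₁ ε) (x₂ ε) (x₃ ε))
      ((mt * (x₃ e * (d₃ / √(x₃ e ^ 2 + mt ^ 2 + ms ^ 2)) * Real.sinh (mt * x₁ e + ms * x₂ e)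
        + √(x₃ e ^ 2 + mt ^ 2 + ms ^ 2)
          * (Real.cosh (mt * x₁ e + ms * x₂ e) * (mt * d₁ + ms * d₂)))
        - ms * (d₃ * Real.sin (mt * x₂ e - ms * x₁ e)
          + x₃ e * (Real.cos (mt * x₂ e - ms * x₁ e) * (mt * d₂ - ms * d₁))))
        / (mt ^ 2 + ms ^ 2)) e := by
  simp only [partialOne, if_neg h0]
  exact (((hasDerivAt_sinh_part h0 h₁ h₂ h₃).const_mul mt).sub
    ((hasDerivAt_sin_part h₁ h₂ h₃).const_mul ms)).div_const _

lemma hasDerivAt_partialTwo_generic (h0 : ¬(ms = 0 ∧ mt = 0)) (h₁ : HasDerivAt x₁ d₁ e)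
    (h₂ : HasDerivAt x₂ d₂ e) (h₃ : HasDerivAt x₃ d₃ e) :
    HasDerivAt (fun ε => partialTwo ms mt (x₁ ε) (x₂ ε) (x₃ ε))
      ((ms * (x₃ e * (d₃ / √(x₃ e ^ 2 + mt ^ 2 + ms ^ 2)) * Real.sinh (mt * x₁ e + ms * x₂ e)
        + √(x₃ e ^ 2 + mt ^ 2 + ms ^ 2)
          * (Real.cosh (mt * x₁ e + ms * x₂ e) * (mt * d₁ + ms * d₂)))
        + mt * (d₃ * Real.sin (mt * x₂ e - ms * x₁ e)
          + x₃ e * (Real.cos (mt * x₂ e - ms * x₁ e) * (mt * d₂ - ms * d₁))))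
        / (mt ^ 2 + ms ^ 2)) e := by
  simp only [partialTwo, if_neg h0]
  exact (((hasDerivAt_sinh_part h0 h₁ h₂ h₃).const_mul ms).add
    ((hasDerivAt_sin_part h₁ h₂ h₃).const_mul mt)).div_const _

lemma hasDerivAt_U_zero (h₁ : HasDerivAt x₁ d₁ e)
    (h₂ : HasDerivAt x₂ d₂ e) (h₃ : HasDerivAt x₃ d₃ e) (hx : x₃ e ≠ 0) :
    HasDerivAt (fun ε => U 0 0 (x₁ ε) (x₂ ε) (x₃ ε))
      (d₃ / 2 * (x₁ e ^ 2 + x₂ e ^ 2) + x₃ e * (x₁ e * d₁ + x₂ e * d₂)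
        - d₃ / (2 * x₃ e ^ 2)) e := by
  have h := ((h₃.div_const 2).mul ((h₁.pow 2).add (h₂.pow 2))).add
    ((hasDerivAt_const e (1 : ℝ)).div (h₃.const_mul 2) (mul_ne_zero two_ne_zero hx))
  simp only [U, ULimit, and_self, if_true]
  refine h.congr_deriv ?_
  simp
  field_simp
  ring

lemma hasDerivAt_partialOne_zero (h₁ : HasDerivAt x₁ d₁ e) (h₃ : HasDerivAt x₃ d₃ e) :
    HasDerivAt (fun ε => partialOne 0 0 (x₁ ε) (x₂ ε) (x₃ ε)) (d₃ * x₁ e + x₃ e * d₁) e := by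
  simp only [partialOne, and_self, if_true]
  exact h₃.mul h₁

lemma hasDerivAt_partialTwo_zero (h₂ : HasDerivAt x₂ d₂ e) (h₃ : HasDerivAt x₃ d₃ e) :
    HasDerivAt (fun ε => partialTwo 0 0 (x₁ ε) (x₂ ε) (x₃ ε)) (d₃ * x₂ e + x₃ e * d₂) e := by
  simp only [partialTwo, and_self, if_true]
  exact h₃.mul h₂

/-- The metric identity, with `dV` the differential of the companion function. -/
lemma metric_identity_of_null {u u₁ u₂ v du du₁ du₂ dv Q : ℝ} (h1 : u * v = 1 + u₁ ^ 2 + u₂ ^ 2)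
    (h2 : u * dv + v * du = 2 * (u₁ * du₁ + u₂ * du₂)) (h3 : du₁ ^ 2 + du₂ ^ 2 - du * dv = Q) :
    (u * du₁ - u₁ * du) ^ 2 + (u * du₂ - u₂ * du) ^ 2 + du ^ 2 = u ^ 2 * Q := by
  linear_combination u ^ 2 * h3 + u * du * h2 - du ^ 2 * h1

/-- Derivatives along a curve of parameters, and the metric coefficients. -/
lemma exists_hasDerivAt (h : ms = 0 ∧ mt = 0 → 0 < x₃ e) (h₁ : HasDerivAt x₁ d₁ e)
    (h₂ : HasDerivAt x₂ d₂ e) (h₃ : HasDerivAt x₃ d₃ e) :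
    ∃ du du₁ du₂ : ℝ, HasDerivAt (fun ε => U ms mt (x₁ ε) (x₂ ε) (x₃ ε)) du e ∧
      HasDerivAt (fun ε => partialOne ms mt (x₁ ε) (x₂ ε) (x₃ ε)) du₁ e ∧
      HasDerivAt (fun ε => partialTwo ms mt (x₁ ε) (x₂ ε) (x₃ ε)) du₂ e ∧
      (U ms mt (x₁ e) (x₂ e) (x₃ e) * du₁ - partialOne ms mt (x₁ e) (x₂ e) (x₃ e) * du) ^ 2
        + (U ms mt (x₁ e) (x₂ e) (x₃ e) * du₂ - partialTwo ms mt (x₁ e) (x₂ e) (x₃ e) * du) ^ 2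
        + du ^ 2
        = U ms mt (x₁ e) (x₂ e) (x₃ e) ^ 2 * ((x₃ e ^ 2 + mt ^ 2) * d₁ ^ 2
          + (x₃ e ^ 2 + ms ^ 2) * d₂ ^ 2 + 2 * ms * mt * d₁ * d₂
          + d₃ ^ 2 / (x₃ e ^ 2 + ms ^ 2 + mt ^ 2)) := by
  by_cases h0 : ms = 0 ∧ mt = 0
  · have hx := h h0
    obtain ⟨rfl, rfl⟩ := h0
    refine ⟨_, _, _, hasDerivAt_U_zero h₁ h₂ h₃ hx.ne', hasDerivAt_partialOne_zero h₁ h₃,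
      hasDerivAt_partialTwo_zero h₂ h₃, ?_⟩
    -- In the limit case the companion is 2α.
    refine metric_identity_of_null (dv := 2 * d₃) (U_mul_companion h) ?_ ?_
    · simp only [U, companion, partialOne, partialTwo, ULimit, and_self, if_true]
      field_simp
      ring
    · field_simp
      ring
  · refine ⟨_, _, _, hasDerivAt_U_generic h0 h₁ h₂ h₃, hasDerivAt_partialOne_generic h0 h₁ h₂ h₃,
      hasDerivAt_partialTwo_generic h0 h₁ h₂ h₃, ?_⟩
    have hN := sq_add_sq_pos h0
    have hβ := Real.sq_sqrt (radicand_pos h0 (x₃ e)).le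
    have hβ0 := Real.sqrt_pos.2 (radicand_pos h0 (x₃ e))
    have hC := Real.cosh_sq (mt * x₁ e + ms * x₂ e)
    have hc := Real.cos_sq_add_sin_sq (mt * x₂ e - ms * x₁ e)
    -- The companion is β cosh A + α cos B, so its differential is that of N·U with the sign of the
    -- cosine part reversed.
    refine metric_identity_of_null
      (dv := x₃ e * (d₃ / √(x₃ e ^ 2 + mt ^ 2 + ms ^ 2)) * Real.cosh (mt * x₁ e + ms * x₂ e)
        + √(x₃ e ^ 2 + mt ^ 2 + ms ^ 2)
          * (Real.sinh (mt * x₁ e + ms * x₂ e) * (mt * d₁ + ms * d₂))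
        + (d₃ * Real.cos (mt * x₂ e - ms * x₁ e)
          + x₃ e * (-Real.sin (mt * x₂ e - ms * x₁ e) * (mt * d₂ - ms * d₁))))
        (U_mul_companion h) ?_ ?_
    · simp only [U, companion, partialOne, partialTwo, UGeneric, if_neg h0]
      set β := √(x₃ e ^ 2 + mt ^ 2 + ms ^ 2)
      set C := Real.cosh (mt * x₁ e + ms * x₂ e)
      set S := Real.sinh (mt * x₁ e + ms * x₂ e)
      set c := Real.cos (mt * x₂ e - ms * x₁ e)
      set n := Real.sin (mt * x₂ e - ms * x₁ e)
      -- With f = dα/β one has dβ = α f and dα = β f, so β leaves the denominators and the identity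
      -- becomes polynomial.
      obtain ⟨f, rfl⟩ : ∃ f, d₃ = β * f := ⟨d₃ / β, by field_simp⟩
      rw [mul_div_cancel_left₀ _ hβ0.ne']
      field_simp
      linear_combination 2 * (mt ^ 2 + ms ^ 2) * (x₃ e * f * β) * (hC - hc)
    · rw [show x₃ e ^ 2 + ms ^ 2 + mt ^ 2 = √(x₃ e ^ 2 + mt ^ 2 + ms ^ 2) ^ 2 by rw [hβ]; ring]
      set β := √(x₃ e ^ 2 + mt ^ 2 + ms ^ 2)
      set C := Real.cosh (mt * x₁ e + ms * x₂ e)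
      set S := Real.sinh (mt * x₁ e + ms * x₂ e)
      set c := Real.cos (mt * x₂ e - ms * x₁ e)
      set n := Real.sin (mt * x₂ e - ms * x₁ e)
      obtain ⟨f, rfl⟩ : ∃ f, d₃ = β * f := ⟨d₃ / β, by field_simp⟩
      rw [mul_div_cancel_left₀ _ hβ0.ne', mul_pow β f, mul_div_cancel_left₀ _ (pow_pos hβ0 2).ne']
      field_simp
      linear_combination (mt ^ 2 + ms ^ 2) * (β ^ 2 * (mt * d₁ + ms * d₂) ^ 2
          - x₃ e ^ 2 * f ^ 2) * hC
        + (mt ^ 2 + ms ^ 2) * (β ^ 2 * f ^ 2 + x₃ e ^ 2 * (mt * d₂ - ms * d₁) ^ 2) * hc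
        + (mt ^ 2 + ms ^ 2) * ((mt * d₁ + ms * d₂) ^ 2 + f ^ 2) * hβ

end Curve

section Partials

variable (ms mt) (t₁ t₂ α : ℝ)

lemma hasDerivAt_U_one :
    HasDerivAt (fun s => U ms mt s t₂ α) (partialOne ms mt t₁ t₂ α) t₁ := by
  by_cases h0 : ms = 0 ∧ mt = 0
  · simp only [U, ULimit, partialOne, if_pos h0]
    refine HasDerivAt.congr_deriv (((((hasDerivAt_id' t₁).pow 2).add_const (t₂ ^ 2)).const_mul (α / 2)).add_const
      (1 / (2 * α))) ?_
    simp
    ring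
  · refine HasDerivAt.congr_deriv (hasDerivAt_U_generic h0 (hasDerivAt_id' t₁) (hasDerivAt_const t₁ t₂)
      (hasDerivAt_const t₁ α)) ?_
    simp [partialOne, if_neg h0]
    ring

lemma hasDerivAt_U_two :
    HasDerivAt (fun s => U ms mt t₁ s α) (partialTwo ms mt t₁ t₂ α) t₂ := by
  by_cases h0 : ms = 0 ∧ mt = 0
  · simp only [U, ULimit, partialTwo, if_pos h0]
    refine HasDerivAt.congr_deriv (((((hasDerivAt_id' t₂).pow 2).const_add (t₁ ^ 2)).const_mul (α / 2)).add_const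
      (1 / (2 * α))) ?_
    simp
    ring
  · refine HasDerivAt.congr_deriv (hasDerivAt_U_generic h0 (hasDerivAt_const t₂ t₁) (hasDerivAt_id' t₂)
      (hasDerivAt_const t₂ α)) ?_
    simp [partialTwo, if_neg h0]
    ring

variable {ms mt α}

/-- This and the next three lemmas give the Hessian of `U` in terms of `U` and `companion` only.
With ms² - mt² = σ and 2 ms mt = τ, the coefficients are those of ξ̃ and ξ̃⋆. -/
lemma hasDerivAt_partialOne_one (h : ms = 0 ∧ mt = 0 → 0 < α) :
    HasDerivAt (fun s => partialOne ms mt s t₂ α)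
      ((companion ms mt t₁ t₂ α - (ms ^ 2 - mt ^ 2) * U ms mt t₁ t₂ α) / 2) t₁ := by
  by_cases h0 : ms = 0 ∧ mt = 0
  · obtain ⟨rfl, rfl⟩ := h0
    refine HasDerivAt.congr_deriv (hasDerivAt_partialOne_zero (x₂ := fun _ => t₂) (hasDerivAt_id' t₁)
      (hasDerivAt_const t₁ α)) ?_
    simp [companion]
  · have hN := sq_add_sq_pos h0
    refine HasDerivAt.congr_deriv (hasDerivAt_partialOne_generic h0 (hasDerivAt_id' t₁) (hasDerivAt_const t₁ t₂)
      (hasDerivAt_const t₁ α)) ?_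
    simp only [companion, U, UGeneric, if_neg h0, zero_div, mul_zero, zero_mul, zero_add]
    field_simp
    ring

lemma hasDerivAt_partialOne_two :
    HasDerivAt (fun s => partialOne ms mt t₁ s α) (ms * mt * U ms mt t₁ t₂ α) t₂ := by
  by_cases h0 : ms = 0 ∧ mt = 0
  · obtain ⟨rfl, rfl⟩ := h0
    refine HasDerivAt.congr_deriv (hasDerivAt_partialOne_zero (x₂ := fun s => s) (hasDerivAt_const t₂ t₁)
      (hasDerivAt_const t₂ α)) ?_
    simp
  · have hN := sq_add_sq_pos h0
    refine HasDerivAt.congr_deriv (hasDerivAt_partialOne_generic h0 (hasDerivAt_const t₂ t₁) (hasDerivAt_id' t₂)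
      (hasDerivAt_const t₂ α)) ?_
    simp only [U, UGeneric, if_neg h0, zero_div, mul_zero, zero_mul, zero_add]
    field_simp
    ring

lemma hasDerivAt_partialTwo_one :
    HasDerivAt (fun s => partialTwo ms mt s t₂ α) (ms * mt * U ms mt t₁ t₂ α) t₁ := by
  by_cases h0 : ms = 0 ∧ mt = 0
  · obtain ⟨rfl, rfl⟩ := h0
    refine HasDerivAt.congr_deriv (hasDerivAt_partialTwo_zero (x₁ := fun s => s) (hasDerivAt_const t₁ t₂)
      (hasDerivAt_const t₁ α)) ?_
    simp
  · have hN := sq_add_sq_pos h0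
    refine HasDerivAt.congr_deriv (hasDerivAt_partialTwo_generic h0 (hasDerivAt_id' t₁) (hasDerivAt_const t₁ t₂)
      (hasDerivAt_const t₁ α)) ?_
    simp only [U, UGeneric, if_neg h0, zero_div, mul_zero, zero_mul, zero_add]
    field_simp
    ring

lemma hasDerivAt_partialTwo_two (h : ms = 0 ∧ mt = 0 → 0 < α) :
    HasDerivAt (fun s => partialTwo ms mt t₁ s α)
      ((companion ms mt t₁ t₂ α + (ms ^ 2 - mt ^ 2) * U ms mt t₁ t₂ α) / 2) t₂ := by
  by_cases h0 : ms = 0 ∧ mt = 0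
  · obtain ⟨rfl, rfl⟩ := h0
    refine HasDerivAt.congr_deriv (hasDerivAt_partialTwo_zero (x₁ := fun _ => t₁) (hasDerivAt_id' t₂)
      (hasDerivAt_const t₂ α)) ?_
    simp [companion]
  · have hN := sq_add_sq_pos h0
    refine HasDerivAt.congr_deriv (hasDerivAt_partialTwo_generic h0 (hasDerivAt_const t₂ t₁) (hasDerivAt_id' t₂)
      (hasDerivAt_const t₂ α)) ?_
    simp only [companion, U, UGeneric, if_neg h0, zero_div, mul_zero, zero_mul, zero_add]
    field_simp
    ring

end Partials

section Smooth

variable {q : ℝ × ℝ × ℝ}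

lemma contDiffAt_U (h : ms = 0 ∧ mt = 0 → 0 < q.2.2) :
    ContDiffAt ℝ ∞ (fun x : ℝ × ℝ × ℝ => U ms mt x.1 x.2.1 x.2.2) q := by
  by_cases h0 : ms = 0 ∧ mt = 0
  · have := (h h0).ne'
    simp only [U, if_pos h0, ULimit]
    fun_prop (disch := simpa using this)
  · have := (radicand_pos h0 q.2.2).ne'
    simp only [U, if_neg h0, UGeneric]
    have h1 : ContDiffAt ℝ ∞ (fun x : ℝ × ℝ × ℝ => √(x.2.2 ^ 2 + mt ^ 2 + ms ^ 2)) q :=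
      ContDiffAt.sqrt (by fun_prop) this
    exact ((h1.mul (by fun_prop)).sub (by fun_prop)).div_const _

lemma contDiffAt_partialOne :
    ContDiffAt ℝ ∞ (fun x : ℝ × ℝ × ℝ => partialOne ms mt x.1 x.2.1 x.2.2) q := by
  by_cases h0 : ms = 0 ∧ mt = 0
  · simp only [partialOne, if_pos h0]
    fun_prop
  · have := (radicand_pos h0 q.2.2).ne'
    simp only [partialOne, if_neg h0]
    have h1 : ContDiffAt ℝ ∞ (fun x : ℝ × ℝ × ℝ => √(x.2.2 ^ 2 + mt ^ 2 + ms ^ 2)) q :=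
      ContDiffAt.sqrt (by fun_prop) this
    exact ((contDiffAt_const.mul (h1.mul (by fun_prop))).sub (by fun_prop)).div_const _

lemma contDiffAt_partialTwo :
    ContDiffAt ℝ ∞ (fun x : ℝ × ℝ × ℝ => partialTwo ms mt x.1 x.2.1 x.2.2) q := by
  by_cases h0 : ms = 0 ∧ mt = 0
  · simp only [partialTwo, if_pos h0]
    fun_prop
  · have := (radicand_pos h0 q.2.2).ne'
    simp only [partialTwo, if_neg h0]
    have h1 : ContDiffAt ℝ ∞ (fun x : ℝ × ℝ × ℝ => √(x.2.2 ^ 2 + mt ^ 2 + ms ^ 2)) q :=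
      ContDiffAt.sqrt (by fun_prop) this
    exact ((contDiffAt_const.mul (h1.mul (by fun_prop))).add (by fun_prop)).div_const _

end Smooth

end Calculus

/-! ### Inverse function theorem on a constraint hypersurface -/

section LocalCoordinates

variable {P E : Type} [NormedAddCommGroup P] [NormedSpace ℝ P] [FiniteDimensional ℝ P]
  [NormedAddCommGroup E] [NormedSpace ℝ E] [FiniteDimensional ℝ E]

/-- The inverse function theorem for a map on a regular hypersurface. -/
lemma isLocalCoordinatesAt_of_injective {Φ : P → E} {c : P → ℝ} {q : P}
    (hΦ : ContDiffAt ℝ ∞ Φ q) (hc : ContDiffAt ℝ ∞ c q) (hq : c q = 1)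
    (hdim : Module.finrank ℝ P = Module.finrank ℝ E + 1)
    (hinj : ∀ v, fderiv ℝ c q v = 0 → fderiv ℝ Φ q v = 0 → v = 0) :
    IsLocalCoordinatesAt {x | c x = 1} Φ q := by
  have : CompleteSpace P := FiniteDimensional.complete ℝ P
  -- Adjoining the constraint as an extra component equalizes the dimensions. The local inverse of
  -- (Φ, c), sliced at constraint value 1, inverts Φ on the hypersurface.
  have hΨ : ContDiffAt ℝ ∞ (fun x => (Φ x, c x)) q := hΦ.prodMk hc
  have hn : (∞ : WithTop ℕ∞) ≠ 0 := by simp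
  have hd : HasFDerivAt (fun x => (Φ x, c x)) ((fderiv ℝ Φ q).prod (fderiv ℝ c q)) q :=
    (hΦ.differentiableAt hn).hasFDerivAt.prodMk (hc.differentiableAt hn).hasFDerivAt
  have hinj' : Function.Injective ((fderiv ℝ Φ q).prod (fderiv ℝ c q) : P →ₗ[ℝ] E × ℝ) := by
    rw [← LinearMap.ker_eq_bot, LinearMap.ker_eq_bot']
    intro v hv
    have hv' : (fderiv ℝ Φ q v, fderiv ℝ c q v) = 0 := hv
    rw [Prod.mk_eq_zero] at hv'
    exact hinj v hv'.2 hv'.1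
  let L : P ≃L[ℝ] E × ℝ := (LinearEquiv.ofInjectiveOfFinrankEq _ hinj'
    (by simp [hdim])).toContinuousLinearEquiv
  have hL : HasFDerivAt (fun x => (Φ x, c x)) (L : P →L[ℝ] E × ℝ) q := hd
  let G := hΨ.localInverse hL hn
  have hG : ContDiffAt ℝ ∞ G (Φ q, 1) := by
    have := hΨ.to_localInverse hL hn
    rwa [hq] at this
  have hr : ∀ᶠ y in 𝓝 (Φ q, (1 : ℝ)), (Φ (G y), c (G y)) = y := by
    have := (hΨ.hasStrictFDerivAt' hL hn).eventually_right_inverse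
    rwa [hq] at this
  have hl : ∀ᶠ x in 𝓝 q, G (Φ x, c x) = x :=
    (hΨ.hasStrictFDerivAt' hL hn).eventually_left_inverse
  refine ⟨hΦ, fun y => G (y, 1), ?_, ?_, ?_⟩
  · exact ContDiffAt.comp (Φ q) (f := fun y => (y, (1 : ℝ))) hG (by fun_prop)
  · have ht : Tendsto (fun y => (y, (1 : ℝ))) (𝓝 (Φ q)) (𝓝 (Φ q, 1)) :=
      Continuous.tendsto (by fun_prop) (Φ q)
    filter_upwards [ht.eventually hr] with y hy
    exact ⟨(Prod.mk.inj hy).2, (Prod.mk.inj hy).1⟩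
  · filter_upwards [mem_nhdsWithin_of_mem_nhds hl, self_mem_nhdsWithin] with x hx hxc
    have hxc' : c x = 1 := hxc
    rwa [hxc'] at hx

end LocalCoordinates

/-! ### Factorization of the chart through (u, u₁, u₂) -/

lemma hasDerivAt_toLp {ι : Type} [Fintype ι] {f : ℝ → ι → ℝ} {f' : ι → ℝ} {e : ℝ}
    (h : ∀ i, HasDerivAt (fun ε => f ε i) (f' i) e) :
    HasDerivAt (fun ε => (WithLp.toLp 2 (f ε) : EuclideanSpace ℝ ι)) (WithLp.toLp 2 f') e :=
  ((PiLp.continuousLinearEquiv 2 ℝ (fun _ : ι => ℝ)).symm :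
    (ι → ℝ) →L[ℝ] EuclideanSpace ℝ ι).hasFDerivAt.comp_hasDerivAt e (hasDerivAt_pi.2 h)

/-- The point with `r = 1 / u`, `z₁ = -u₁ / u`, `z₂ = u₂ / u` and the given polar coordinates. -/
def assemble {p : ℕ} (u u₁ u₂ : ℝ) (a φ : Fin p → ℝ) : EvenSpace p :=
  WithLp.toLp 2 (Sum.elim ![-u₁ / u, u₂ / u]
    (fun k => ![a k.1 / u * Real.cos (φ k.1), a k.1 / u * Real.sin (φ k.1)] k.2))

section Assemble

variable {p : ℕ} (u u₁ u₂ : ℝ) (a φ : Fin p → ℝ)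

@[simp] lemma assemble_inl_zero : assemble u u₁ u₂ a φ (Sum.inl 0) = -u₁ / u := rfl

@[simp] lemma assemble_inl_one : assemble u u₁ u₂ a φ (Sum.inl 1) = u₂ / u := rfl

@[simp] lemma assemble_inr_zero (i : Fin p) :
    assemble u u₁ u₂ a φ (Sum.inr (i, 0)) = a i / u * Real.cos (φ i) := rfl

@[simp] lemma assemble_inr_one (i : Fin p) :
    assemble u u₁ u₂ a φ (Sum.inr (i, 1)) = a i / u * Real.sin (φ i) := rfl

variable {a}

lemma axialSq_assemble (ha : ∑ i, a i ^ 2 = 1) : axialSq (assemble u u₁ u₂ a φ) = 1 / u ^ 2 := by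
  calc axialSq (assemble u u₁ u₂ a φ) = ∑ i, a i ^ 2 * (1 / u ^ 2) := by
        refine Finset.sum_congr rfl fun i _ => ?_
        rw [assemble_inr_zero, assemble_inr_one]
        linear_combination (a i / u) ^ 2 * Real.cos_sq_add_sin_sq (φ i)
    _ = 1 / u ^ 2 := by rw [← Finset.sum_mul, ha, one_mul]

end Assemble

lemma evenSpace_ext {p : ℕ} {x y : EvenSpace p} (h0 : x (Sum.inl 0) = y (Sum.inl 0))
    (h1 : x (Sum.inl 1) = y (Sum.inl 1)) (h2 : ∀ i, x (Sum.inr (i, 0)) = y (Sum.inr (i, 0)))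
    (h3 : ∀ i, x (Sum.inr (i, 1)) = y (Sum.inr (i, 1))) : x = y := by
  ext A
  rcases A with j | ⟨i, j⟩ <;> fin_cases j
  · exact h0
  · exact h1
  · exact h2 i
  · exact h3 i

/-- Replaces the derivatives in the definition of the chart by closed forms, which can be
differentiated again and inverted. -/
lemma evenChart_eq {p : ℕ} (ms mt t₁ t₂ α : ℝ) (a φ : Fin p → ℝ) :
    evenChart ms mt t₁ t₂ α a φ = assemble (U ms mt t₁ t₂ α) (partialOne ms mt t₁ t₂ α)
      (partialTwo ms mt t₁ t₂ α) a φ := by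
  apply evenSpace_ext
  · simp only [evenChart, (hasDerivAt_U_one ms mt t₁ t₂ α).deriv]
    simp
    ring
  · simp only [evenChart, (hasDerivAt_U_two ms mt t₁ t₂ α).deriv]
    simp
    ring
  · intro i
    rfl
  · intro i
    rfl

/-- The derivative of `assemble` along a curve. -/
def assembleDeriv {p : ℕ} (u u₁ u₂ : ℝ) (a φ : Fin p → ℝ) (du du₁ du₂ : ℝ) (da dφ : Fin p → ℝ) :
    EvenSpace p :=
  WithLp.toLp 2 (Sum.elim ![-(u * du₁ - u₁ * du) / u ^ 2, (u * du₂ - u₂ * du) / u ^ 2]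
    (fun k => ![(da k.1 * u - a k.1 * du) / u ^ 2 * Real.cos (φ k.1)
        - a k.1 / u * dφ k.1 * Real.sin (φ k.1),
      (da k.1 * u - a k.1 * du) / u ^ 2 * Real.sin (φ k.1)
        + a k.1 / u * dφ k.1 * Real.cos (φ k.1)] k.2))

section AssembleDeriv

variable {p : ℕ}

lemma hasDerivAt_assemble {u u₁ u₂ : ℝ → ℝ} {a φ : ℝ → Fin p → ℝ} {du du₁ du₂ e : ℝ}
    {da dφ : Fin p → ℝ} (hu0 : u e ≠ 0) (hu : HasDerivAt u du e) (hu₁ : HasDerivAt u₁ du₁ e)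
    (hu₂ : HasDerivAt u₂ du₂ e) (ha : ∀ i, HasDerivAt (fun ε => a ε i) (da i) e)
    (hφ : ∀ i, HasDerivAt (fun ε => φ ε i) (dφ i) e) :
    HasDerivAt (fun ε => assemble (u ε) (u₁ ε) (u₂ ε) (a ε) (φ ε))
      (assembleDeriv (u e) (u₁ e) (u₂ e) (a e) (φ e) du du₁ du₂ da dφ) e := by
  refine hasDerivAt_toLp fun A => ?_
  rcases A with j | ⟨i, j⟩ <;> fin_cases j
  · refine (hu₁.neg.div hu hu0).congr_deriv ?_
    simp
    ring
  · refine (hu₂.div hu hu0).congr_deriv ?_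
    simp
    ring
  · refine (((ha i).div hu hu0).mul (hφ i).cos).congr_deriv ?_
    simp
    ring
  · refine (((ha i).div hu hu0).mul (hφ i).sin).congr_deriv ?_
    simp
    ring

lemma contDiffAt_assemble {P : Type} [NormedAddCommGroup P] [NormedSpace ℝ P]
    {u u₁ u₂ : P → ℝ} {a φ : P → Fin p → ℝ} {q : P} (hu0 : u q ≠ 0)
    (hu : ContDiffAt ℝ ∞ u q) (hu₁ : ContDiffAt ℝ ∞ u₁ q) (hu₂ : ContDiffAt ℝ ∞ u₂ q)
    (ha : ContDiffAt ℝ ∞ a q) (hφ : ContDiffAt ℝ ∞ φ q) :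
    ContDiffAt ℝ ∞ (fun q => assemble (u q) (u₁ q) (u₂ q) (a q) (φ q)) q := by
  have ha' := contDiffAt_pi.1 ha
  have hφ' := contDiffAt_pi.1 hφ
  refine contDiffAt_piLp' 2 fun A => ?_
  rcases A with j | ⟨i, j⟩ <;> fin_cases j
  · exact hu₁.neg.div hu hu0
  · exact hu₂.div hu hu0
  · exact ((ha' i).div hu hu0).mul (hφ' i).cos
  · exact ((ha' i).div hu hu0).mul (hφ' i).sin

/-- The conformal splitting into H³ times a sphere. On tangent vectors of ∑ a_i² = 1 the cross terms
a_i da_i cancel; the remaining radial term du²/u⁴ = dr² completes the hyperbolic part, for which `Q`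
is the prescribed value. -/
lemma norm_assembleDeriv_sq {u u₁ u₂ : ℝ} (hu0 : u ≠ 0) {a φ : Fin p → ℝ} {du du₁ du₂ Q : ℝ}
    {da dφ : Fin p → ℝ} (ha : ∑ i, a i ^ 2 = 1) (hda : ∑ i, a i * da i = 0)
    (hQ : (u * du₁ - u₁ * du) ^ 2 + (u * du₂ - u₂ * du) ^ 2 + du ^ 2 = u ^ 2 * Q) :
    ‖assembleDeriv u u₁ u₂ a φ du du₁ du₂ da dφ‖ ^ 2
      = 1 / u ^ 2 * (Q + sphereForm a da dφ) := by
  have hs : ∑ i, ((da i * u - a i * du) ^ 2 / u ^ 4 + a i ^ 2 * dφ i ^ 2 / u ^ 2)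
      = 1 / u ^ 2 * sphereForm a da dφ + du ^ 2 / u ^ 4 := by
    calc _ = ∑ i, (1 / u ^ 2 * (da i ^ 2 + a i ^ 2 * dφ i ^ 2) - 2 * du / u ^ 3 * (a i * da i)
          + du ^ 2 / u ^ 4 * a i ^ 2) := by
          refine Finset.sum_congr rfl fun i _ => ?_
          field_simp
          ring
      _ = _ := by
          rw [Finset.sum_add_distrib, Finset.sum_sub_distrib, ← Finset.mul_sum, ← Finset.mul_sum,
            ← Finset.mul_sum, ha, hda, sphereForm]
          ring
  have hw : ∀ i, ((da i * u - a i * du) / u ^ 2 * Real.cos (φ i)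
        - a i / u * dφ i * Real.sin (φ i)) ^ 2
      + ((da i * u - a i * du) / u ^ 2 * Real.sin (φ i)
        + a i / u * dφ i * Real.cos (φ i)) ^ 2
      = (da i * u - a i * du) ^ 2 / u ^ 4 + a i ^ 2 * dφ i ^ 2 / u ^ 2 := fun i => by
    linear_combination (((da i * u - a i * du) / u ^ 2) ^ 2 + (a i / u * dφ i) ^ 2)
      * Real.cos_sq_add_sin_sq (φ i)
  rw [EuclideanSpace.norm_sq_eq]
  simp only [assembleDeriv, Fintype.sum_sum_type, Fintype.sum_prod_type, Fin.sum_univ_two,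
    Sum.elim_inl, Sum.elim_inr, Matrix.cons_val_zero, Matrix.cons_val_one, Real.norm_eq_abs,
    sq_abs, hw, hs]
  field_simp
  linear_combination hQ

end AssembleDeriv

/-! ### Smoothness and the pulled-back metric -/

section EvenMap

variable {p : ℕ} {ms mt : ℝ}

lemma evenMap_eq : evenMap (p := p) ms mt = fun q => assemble (U ms mt q.1 q.2.1 q.2.2.1)
    (partialOne ms mt q.1 q.2.1 q.2.2.1) (partialTwo ms mt q.1 q.2.1 q.2.2.1)
    q.2.2.2.1 q.2.2.2.2 :=
  funext fun _ => evenChart_eq ..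

lemma contDiffAt_evenMap {q : EvenParam p} (h : ms = 0 ∧ mt = 0 → 0 < q.2.2.1) :
    ContDiffAt ℝ ∞ (evenMap (p := p) ms mt) q := by
  have hl : ContDiffAt ℝ ∞ (fun q : EvenParam p => (q.1, q.2.1, q.2.2.1)) q := by fun_prop
  have hu := contDiffAt_U (ms := ms) (mt := mt) (q := (q.1, q.2.1, q.2.2.1)) h
  have hu₁ := contDiffAt_partialOne (ms := ms) (mt := mt) (q := (q.1, q.2.1, q.2.2.1))
  have hu₂ := contDiffAt_partialTwo (ms := ms) (mt := mt) (q := (q.1, q.2.1, q.2.2.1))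
  have hu := hu.fun_comp (f := fun q : EvenParam p => (q.1, q.2.1, q.2.2.1)) q hl
  have hu₁ := hu₁.fun_comp (f := fun q : EvenParam p => (q.1, q.2.1, q.2.2.1)) q hl
  have hu₂ := hu₂.fun_comp (f := fun q : EvenParam p => (q.1, q.2.1, q.2.2.1)) q hl
  have ha : ContDiffAt ℝ ∞ (fun q : EvenParam p => q.2.2.2.1) q := by fun_prop
  have hφ : ContDiffAt ℝ ∞ (fun q : EvenParam p => q.2.2.2.2) q := by fun_prop
  rw [evenMap_eq]
  exact contDiffAt_assemble (U_pos h).ne' hu hu₁ hu₂ ha hφ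

lemma hasDerivAt_line {q : EvenParam p} (v : EvenParam p)
    (h : ms = 0 ∧ mt = 0 → 0 < q.2.2.1) :
    HasDerivAt (fun ε : ℝ => evenMap ms mt (q + ε • v)) (fderiv ℝ (evenMap ms mt) q v) 0 := by
  have h1 : HasDerivAt (fun ε : ℝ => q + ε • v) v 0 := by
    simpa using ((hasDerivAt_id (0 : ℝ)).smul_const v).const_add q
  have h2 : HasFDerivAt (evenMap ms mt) (fderiv ℝ (evenMap ms mt) q) (q + (0 : ℝ) • v) := by
    simpa using ((contDiffAt_evenMap h).differentiableAt (by simp)).hasFDerivAt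
  exact h2.comp_hasDerivAt 0 h1

/-- The metric in adapted coordinates. -/
lemma norm_fderiv_evenMap_sq {q : EvenParam p} {v : EvenParam p}
    (h : ms = 0 ∧ mt = 0 → 0 < q.2.2.1) (ha : ∑ i, q.2.2.2.1 i ^ 2 = 1)
    (hv : ∑ i, q.2.2.2.1 i * v.2.2.2.1 i = 0) :
    ‖fderiv ℝ (evenMap ms mt) q v‖ ^ 2
      = evenMetric ms mt q.1 q.2.1 q.2.2.1 q.2.2.2.1 v := by
  have hline : ∀ x d : ℝ, HasDerivAt (fun ε : ℝ => x + ε * d) d 0 := fun x d => by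
    simpa using ((hasDerivAt_id (0 : ℝ)).mul_const d).const_add x
  obtain ⟨du, du₁, du₂, hu, hu₁, hu₂, hQ⟩ := exists_hasDerivAt (ms := ms) (mt := mt)
    (x₃ := fun ε => q.2.2.1 + ε * v.2.2.1) (by simpa using h)
    (hline q.1 v.1) (hline q.2.1 v.2.1) (hline q.2.2.1 v.2.2.1)
  have h1 : HasDerivAt (fun ε : ℝ => evenMap ms mt (q + ε • v)) _ 0 :=
    (hasDerivAt_assemble (by simpa using (U_pos h).ne') hu hu₁ hu₂
      (fun i => hline (q.2.2.2.1 i) (v.2.2.2.1 i))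
      (fun i => hline (q.2.2.2.2 i) (v.2.2.2.2 i))).congr_of_eventuallyEq
      (Eventually.of_forall fun ε => evenChart_eq ..)
  -- The line q + ε v leaves the constraint surface, but only its velocity at ε = 0 enters, and that
  -- velocity is tangent by `hv`.
  rw [(hasDerivAt_line v h).unique h1, norm_assembleDeriv_sq _ _ _ hQ, evenMetric]
  · simp only [zero_mul, add_zero]
  · simpa using (U_pos h).ne'
  · simpa using ha
  · simpa using hv

end EvenMap

/-! ### The coordinate vector fields -/

section Fields

variable {p : ℕ} {ms mt σ τ : ℝ} (t₁ t₂ : ℝ) {α : ℝ} {a : Fin p → ℝ} (φ : Fin p → ℝ)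

/-- For the z₁-component, ∂₁(-u₁/u) = -u₁₁/u + u₁²/u². Insert u₁₁ = (v - σ u)/2 and v = (1 + u₁² +
u₂²)/u; with r = 1/u this is (σ + z₁² - z₂² - r²)/2. The other components are similar. -/
lemma hasDerivAt_evenChart_one (hσ : ms ^ 2 - mt ^ 2 = σ) (hτ : 2 * ms * mt = τ)
    (h : ms = 0 ∧ mt = 0 → 0 < α) (ha : ∑ i, a i ^ 2 = 1) :
    HasDerivAt (fun s => evenChart ms mt s t₂ α a φ)
      (xiEven σ τ (evenChart ms mt t₁ t₂ α a φ)) t₁ := by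
  have hu0 := (U_pos (t₁ := t₁) (t₂ := t₂) h).ne'
  have huv := U_mul_companion (t₁ := t₁) (t₂ := t₂) h
  simp only [evenChart_eq]
  refine (hasDerivAt_assemble (u := fun s => U ms mt s t₂ α) (u₁ := fun s => partialOne ms mt s t₂ α) 
    (u₂ := fun s => partialTwo ms mt s t₂ α)
    (a := fun _ => a) (φ := fun _ => φ) hu0 (hasDerivAt_U_one ..) (hasDerivAt_partialOne_one t₁ t₂ h)
    (hasDerivAt_partialTwo_one t₁ t₂) (fun i => hasDerivAt_const t₁ (a i))
    (fun i => hasDerivAt_const t₁ (φ i))).congr_deriv ?_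
  rw [hσ]
  refine evenSpace_ext ?_ ?_ (fun i => ?_) fun i => ?_
  · rw [xiEven_inl_zero, axialSq_assemble _ _ _ _ ha]
    simp [assembleDeriv]
    field_simp
    linear_combination -huv
  · simp [assembleDeriv]
    field_simp
    linear_combination U ms mt t₁ t₂ α ^ 2 * hτ
  · simp [assembleDeriv]
    ring
  · simp [assembleDeriv]
    ring

lemma hasDerivAt_evenChart_two (hσ : ms ^ 2 - mt ^ 2 = σ) (hτ : 2 * ms * mt = τ)
    (h : ms = 0 ∧ mt = 0 → 0 < α) (ha : ∑ i, a i ^ 2 = 1) :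
    HasDerivAt (fun s => evenChart ms mt t₁ s α a φ)
      (xiStarEven σ τ (evenChart ms mt t₁ t₂ α a φ)) t₂ := by
  have hu0 := (U_pos (t₁ := t₁) (t₂ := t₂) h).ne'
  have huv := U_mul_companion (t₁ := t₁) (t₂ := t₂) h
  simp only [evenChart_eq]
  refine (hasDerivAt_assemble (u := fun s => U ms mt t₁ s α) (u₁ := fun s => partialOne ms mt t₁ s α) 
    (u₂ := fun s => partialTwo ms mt t₁ s α)
    (a := fun _ => a) (φ := fun _ => φ) hu0 (hasDerivAt_U_two ..) (hasDerivAt_partialOne_two t₁ t₂)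
    (hasDerivAt_partialTwo_two t₁ t₂ h) (fun i => hasDerivAt_const t₂ (a i))
    (fun i => hasDerivAt_const t₂ (φ i))).congr_deriv ?_
  rw [hσ]
  refine evenSpace_ext ?_ ?_ (fun i => ?_) fun i => ?_
  · simp [assembleDeriv]
    field_simp
    linear_combination -U ms mt t₁ t₂ α ^ 2 * hτ
  · rw [xiStarEven_inl_one, axialSq_assemble _ _ _ _ ha]
    simp [assembleDeriv]
    field_simp
    linear_combination huv
  · simp [assembleDeriv]
    ring
  · simp [assembleDeriv]
    ring

lemma hasDerivAt_evenChart_angle (h : ms = 0 ∧ mt = 0 → 0 < α) (i : Fin p) :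
    HasDerivAt (fun s => evenChart ms mt t₁ t₂ α a (Function.update φ i s))
      (eta i (evenChart ms mt t₁ t₂ α a φ)) (φ i) := by
  have hu0 := (U_pos (t₁ := t₁) (t₂ := t₂) h).ne'
  simp only [evenChart_eq]
  refine (hasDerivAt_assemble (e := φ i) (u := fun _ => U ms mt t₁ t₂ α)
    (u₁ := fun _ => partialOne ms mt t₁ t₂ α) (u₂ := fun _ => partialTwo ms mt t₁ t₂ α)
    (a := fun _ => a) (φ := fun s => Function.update φ i s) hu0
    (hasDerivAt_const (φ i) _) (hasDerivAt_const (φ i) _)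
    (hasDerivAt_const (φ i) _) (fun j => hasDerivAt_const (φ i) (a j))
    (hasDerivAt_pi.1 (hasDerivAt_update φ i (φ i)))).congr_deriv ?_
  refine evenSpace_ext ?_ ?_ (fun j => ?_) fun j => ?_
  · simp [assembleDeriv]
  · simp [assembleDeriv]
  · by_cases hj : j = i
    · subst hj
      simp [assembleDeriv]
    · simp [assembleDeriv, hj]
  · by_cases hj : j = i
    · subst hj
      simp [assembleDeriv]
    · simp [assembleDeriv, hj]

end Fields

/-- The derivative of `∑ α_i²`. -/
lemma sum_mul_eq_zero_of_fderiv {P : Type} [NormedAddCommGroup P] [NormedSpace ℝ P] {p : ℕ}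
    (L : P →L[ℝ] (Fin p → ℝ)) (q v : P)
    (h : fderiv ℝ (fun x => ∑ i, L x i ^ 2) q v = 0) : ∑ i, L q i * L v i = 0 := by
  have hd : DifferentiableAt ℝ (fun x => ∑ i, L x i ^ 2) q := by fun_prop
  have hl : HasLineDerivAt ℝ (fun x => ∑ i, L x i ^ 2) (∑ i, 2 * L q i * L v i) q v := by
    refine HasDerivAt.fun_sum fun i _ => ?_
    have h1 : HasDerivAt (fun ε : ℝ => L (q + ε • v) i) (L v i) 0 := by
      simpa using ((hasDerivAt_id (0 : ℝ)).mul_const (L v i)).const_add (L q i)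
    simpa using h1.fun_pow 2
  rw [← hd.lineDeriv_eq_fderiv, hl.lineDeriv] at h
  simp_rw [mul_assoc] at h
  rw [← Finset.mul_sum] at h
  linarith

/-- The (t₁, t₂) part of the metric is the sum of squares α²(dt₁² + dt₂²) + (mt dt₁ + ms dt₂)². It
is left unresolved because α = 0 may occur in odd dimension, where the second square alone controls
dt₁. -/
lemma eq_zero_of_evenMetric {p : ℕ} {ms mt t₁ t₂ α : ℝ} {a : Fin p → ℝ} {v : EvenParam p}
    (h : ms = 0 ∧ mt = 0 → 0 < α) (ha : ∀ i, 0 < a i) (hv : evenMetric ms mt t₁ t₂ α a v = 0) :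
    α ^ 2 * (v.1 ^ 2 + v.2.1 ^ 2) + (mt * v.1 + ms * v.2.1) ^ 2 = 0 ∧ v.2.2.1 = 0 ∧
      v.2.2.2.1 = 0 ∧ v.2.2.2.2 = 0 := by
  have hu := U_pos (t₁ := t₁) (t₂ := t₂) h
  have hr : 0 < α ^ 2 + ms ^ 2 + mt ^ 2 := by
    by_cases h0 : ms = 0 ∧ mt = 0
    · have := h h0
      positivity
    · linarith [radicand_pos h0 α]
  have hnn : ∀ i, 0 ≤ v.2.2.2.1 i ^ 2 + a i ^ 2 * v.2.2.2.2 i ^ 2 := fun i => by positivity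
  have hs : 0 ≤ sphereForm a v.2.2.2.1 v.2.2.2.2 := Finset.sum_nonneg fun i _ => hnn i
  have hq : 0 ≤ α ^ 2 * (v.1 ^ 2 + v.2.1 ^ 2) + (mt * v.1 + ms * v.2.1) ^ 2 := by positivity
  have hα : 0 ≤ v.2.2.1 ^ 2 / (α ^ 2 + ms ^ 2 + mt ^ 2) := by positivity
  have hsum := (mul_eq_zero.1 hv).resolve_left (by positivity)
  have hα0 : v.2.2.1 ^ 2 / (α ^ 2 + ms ^ 2 + mt ^ 2) = 0 := by nlinarith
  have hs0 : sphereForm a v.2.2.2.1 v.2.2.2.2 = 0 := by nlinarith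
  have hi := (Finset.sum_eq_zero_iff_of_nonneg fun i _ => hnn i).1 hs0
  refine ⟨by nlinarith, ?_, ?_, ?_⟩
  · simpa [hr.ne'] using hα0
  · ext i
    have := hi i (Finset.mem_univ i)
    have : v.2.2.2.1 i ^ 2 = 0 := by nlinarith [sq_nonneg (v.2.2.2.1 i), sq_nonneg (a i * v.2.2.2.2 i)]
    simpa using this
  · ext i
    have := hi i (Finset.mem_univ i)
    have : (a i * v.2.2.2.2 i) ^ 2 = 0 := by
      nlinarith [sq_nonneg (v.2.2.2.1 i), sq_nonneg (a i * v.2.2.2.2 i)]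
    simpa [(ha i).ne'] using this

lemma isLocalCoordinatesAt_evenMap {p : ℕ} {ms mt : ℝ} {q : EvenParam p} (hα : 0 < q.2.2.1)
    (ha : ∀ i, 0 < q.2.2.2.1 i) (hq : ∑ i, q.2.2.2.1 i ^ 2 = 1) :
    IsLocalCoordinatesAt (evenConstraint p) (evenMap ms mt) q := by
  refine isLocalCoordinatesAt_of_injective (c := fun q : EvenParam p => ∑ i, q.2.2.2.1 i ^ 2)
    (contDiffAt_evenMap fun _ => hα) (by fun_prop) hq ?_ ?_
  · simp [Module.finrank_prod]
    ring
  · intro v hc hv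
    have hav := sum_mul_eq_zero_of_fderiv
      ((ContinuousLinearMap.fst ℝ (Fin p → ℝ) (Fin p → ℝ)).comp
        ((ContinuousLinearMap.snd ℝ ℝ _).comp
          ((ContinuousLinearMap.snd ℝ ℝ _).comp (ContinuousLinearMap.snd ℝ ℝ _)))) q v hc
    have hm := norm_fderiv_evenMap_sq (fun _ => hα) hq hav (ms := ms) (mt := mt)
    rw [hv, norm_zero, zero_pow two_ne_zero] at hm
    obtain ⟨h1, h2, h3, h4⟩ := eq_zero_of_evenMetric (fun _ => hα) ha hm.symm
    have h5 : v.1 ^ 2 + v.2.1 ^ 2 = 0 := by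
      have : q.2.2.1 ^ 2 * (v.1 ^ 2 + v.2.1 ^ 2) = 0 := by
        nlinarith [sq_nonneg (mt * v.1 + ms * v.2.1), show 0 ≤ q.2.2.1 ^ 2 * (v.1 ^ 2 + v.2.1 ^ 2)
          by positivity]
      exact (mul_eq_zero.1 this).resolve_left (by positivity)
    have h6 : v.1 = 0 := by nlinarith [sq_nonneg v.2.1, sq_nonneg v.1]
    have h7 : v.2.1 = 0 := by nlinarith [sq_nonneg v.2.1, sq_nonneg v.1]
    exact Prod.ext h6 (Prod.ext h7 (Prod.ext h2 (Prod.ext h3 h4)))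

/-! ### Inverting the coordinates -/

section Polar

lemma exists_polar {x y : ℝ} (h : ¬(x = 0 ∧ y = 0)) :
    ∃ r θ : ℝ, 0 < r ∧ θ ∈ Ico (-Real.pi) Real.pi ∧ r * Real.cos θ = x ∧ r * Real.sin θ = y := by
  have hz : (⟨x, y⟩ : ℂ) ≠ 0 := fun hz => h ⟨congrArg Complex.re hz, congrArg Complex.im hz⟩
  have hx := Complex.norm_mul_cos_arg ⟨x, y⟩
  have hy := Complex.norm_mul_sin_arg ⟨x, y⟩
  have hm := Complex.arg_mem_Ioc ⟨x, y⟩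
  -- `Complex.arg` takes values in (-π, π]; the value π is moved to -π.
  by_cases hπ : Complex.arg ⟨x, y⟩ = Real.pi
  · refine ⟨_, -Real.pi, norm_pos_iff.2 hz, ⟨le_rfl, by linarith [Real.pi_pos]⟩, ?_, ?_⟩
    · rw [Real.cos_neg, ← hπ]
      exact hx
    · rw [Real.sin_neg, Real.sin_pi, neg_zero, ← Real.sin_pi, ← hπ]
      exact hy
  · exact ⟨_, _, norm_pos_iff.2 hz, ⟨hm.1.le, lt_of_le_of_ne hm.2 hπ⟩, hx, hy⟩

lemma polar_unique {r s θ ψ : ℝ} (hr : 0 < r) (hs : 0 < s) (hθ : θ ∈ Ico (-Real.pi) Real.pi)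
    (hψ : ψ ∈ Ico (-Real.pi) Real.pi) (hc : r * Real.cos θ = s * Real.cos ψ)
    (hn : r * Real.sin θ = s * Real.sin ψ) : r = s ∧ θ = ψ := by
  have h1 : r ^ 2 = s ^ 2 := by
    linear_combination (r * Real.cos θ + s * Real.cos ψ) * hc
      + (r * Real.sin θ + s * Real.sin ψ) * hn - r ^ 2 * Real.cos_sq_add_sin_sq θ
      + s ^ 2 * Real.cos_sq_add_sin_sq ψ
  obtain rfl : r = s := (sq_eq_sq₀ hr.le hs.le).1 h1
  refine ⟨rfl, ?_⟩
  obtain ⟨k, hk⟩ := Real.Angle.angle_eq_iff_two_pi_dvd_sub.1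
    (Real.Angle.cos_sin_inj (mul_left_cancel₀ hr.ne' hc) (mul_left_cancel₀ hr.ne' hn))
  have hπ := Real.pi_pos
  -- Two angles in a half-open interval of length 2π differ by less than 2π.
  have h2 : (k : ℝ) < 1 := by nlinarith [hθ.1, hθ.2, hψ.1, hψ.2]
  have h3 : (-1 : ℝ) < k := by nlinarith [hθ.1, hθ.2, hψ.1, hψ.2]
  have h4 : k = 0 := by
    have h2' : k < 1 := by exact_mod_cast h2
    have h3' : -1 < k := by exact_mod_cast h3
    omega
  rw [h4] at hk
  simp at hk
  linarith

end Polar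

section Core

variable {ms mt : ℝ}

/-- The invariants `α cos B`, `α sin B` and `√(α² + μ_s² + μ_t²) sinh A` in terms of `U` and its
derivatives. -/
lemma generic_invariants (h0 : ¬(ms = 0 ∧ mt = 0)) (t₁ t₂ α : ℝ) :
    α * Real.cos (mt * t₂ - ms * t₁)
      = ((1 + partialOne ms mt t₁ t₂ α ^ 2 + partialTwo ms mt t₁ t₂ α ^ 2) / U ms mt t₁ t₂ α
        - (mt ^ 2 + ms ^ 2) * U ms mt t₁ t₂ α) / 2 ∧
    α * Real.sin (mt * t₂ - ms * t₁)
      = mt * partialTwo ms mt t₁ t₂ α - ms * partialOne ms mt t₁ t₂ α ∧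
    √(α ^ 2 + mt ^ 2 + ms ^ 2) * Real.sinh (mt * t₁ + ms * t₂)
      = mt * partialOne ms mt t₁ t₂ α + ms * partialTwo ms mt t₁ t₂ α := by
  have hN := (sq_add_sq_pos h0).ne'
  have hu := (U_pos (t₁ := t₁) (t₂ := t₂) (α := α) fun h => absurd h h0).ne'
  rw [← U_mul_companion (fun h => absurd h h0), mul_div_cancel_left₀ _ hu]
  simp only [U, UGeneric, companion, partialOne, partialTwo, if_neg h0]
  refine ⟨?_, ?_, ?_⟩ <;> field_simp <;> ring

/-- Solving for the coordinates in terms of the invariants. -/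
lemma exists_of_invariants (h0 : ¬(ms = 0 ∧ mt = 0)) {u u₁ u₂ α B : ℝ} (hu : 0 < u)
    (hc : α * Real.cos B = ((1 + u₁ ^ 2 + u₂ ^ 2) / u - (mt ^ 2 + ms ^ 2) * u) / 2)
    (hn : α * Real.sin B = mt * u₂ - ms * u₁) :
    ∃ t₁ t₂ : ℝ, mt * t₂ - ms * t₁ = B ∧ U ms mt t₁ t₂ α = u ∧
      partialOne ms mt t₁ t₂ α = u₁ ∧ partialTwo ms mt t₁ t₂ α = u₂ := by
  have hN := sq_add_sq_pos h0
  have hβ := Real.sq_sqrt (radicand_pos h0 α).le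
  have hβ0 := Real.sqrt_pos.2 (radicand_pos h0 α)
  set β := √(α ^ 2 + mt ^ 2 + ms ^ 2) with hβd
  -- A is determined by the invariant β sinh A. The value of β cosh A then follows from β² cosh² A =
  -- β² sinh² A + α² + N, both candidates being nonnegative.
  obtain ⟨A, hA⟩ : ∃ A, β * Real.sinh A = mt * u₁ + ms * u₂ :=
    ⟨Real.arsinh ((mt * u₁ + ms * u₂) / β), by rw [Real.sinh_arsinh]; field_simp⟩
  have hC : β * Real.cosh A = ((1 + u₁ ^ 2 + u₂ ^ 2) / u + (mt ^ 2 + ms ^ 2) * u) / 2 := by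
    refine (sq_eq_sq₀ (mul_nonneg hβ0.le (Real.cosh_pos A).le) (by positivity)).1 ?_
    have e : (β * Real.cosh A) ^ 2 = (β * Real.sinh A) ^ 2 + (α * Real.cos B) ^ 2
        + (α * Real.sin B) ^ 2 + (mt ^ 2 + ms ^ 2) := by
      linear_combination β ^ 2 * Real.cosh_sq A + hβ - α ^ 2 * Real.cos_sq_add_sin_sq B
    rw [e, hA, hc, hn]
    field_simp
    ring
  have e1 : mt * ((mt * A - ms * B) / (mt ^ 2 + ms ^ 2))
      + ms * ((ms * A + mt * B) / (mt ^ 2 + ms ^ 2)) = A := by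
    field_simp
    ring
  have e2 : mt * ((ms * A + mt * B) / (mt ^ 2 + ms ^ 2))
      - ms * ((mt * A - ms * B) / (mt ^ 2 + ms ^ 2)) = B := by
    field_simp
    ring
  -- The solution of mt t₁ + ms t₂ = A, mt t₂ - ms t₁ = B, a system of determinant mt² + ms².
  refine ⟨(mt * A - ms * B) / (mt ^ 2 + ms ^ 2), (ms * A + mt * B) / (mt ^ 2 + ms ^ 2), e2, ?_⟩
  simp only [U, UGeneric, partialOne, partialTwo, if_neg h0, e1, e2, ← hβd, hA, hC, hc, hn]
  refine ⟨?_, ?_, ?_⟩ <;> field_simp <;> ring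

/-- The hypothesis says that the would-be pair (α cos B, α sin B) is not the origin, that is, the
point lies off the rotation axis; then (α, B) are its polar coordinates. -/
lemma exists_coordinates {u u₁ u₂ : ℝ} (hu : 0 < u)
    (h : ¬(ms = 0 ∧ mt = 0) →
      ¬(mt * u₂ - ms * u₁ = 0 ∧ 1 + u₁ ^ 2 + u₂ ^ 2 = (mt ^ 2 + ms ^ 2) * u ^ 2)) :
    ∃ t₁ t₂ α : ℝ, (t₁, t₂) ∈ band ms mt ∧ 0 < α ∧ U ms mt t₁ t₂ α = u ∧
      partialOne ms mt t₁ t₂ α = u₁ ∧ partialTwo ms mt t₁ t₂ α = u₂ := by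
  by_cases h0 : ms = 0 ∧ mt = 0
  -- In the limit case v = 2α and u_i = α t_i, with v = (1 + u₁² + u₂²)/u.
  · have hα : 0 < (1 + u₁ ^ 2 + u₂ ^ 2) / (2 * u) := by positivity
    refine ⟨u₁ / ((1 + u₁ ^ 2 + u₂ ^ 2) / (2 * u)), u₂ / ((1 + u₁ ^ 2 + u₂ ^ 2) / (2 * u)), _, ?_,
      hα, ?_, ?_, ?_⟩
    · simp [band, h0.1, h0.2, Real.pi_pos, Real.pi_pos.le]
    · simp only [U, if_pos h0, ULimit]
      field_simp
      ring
    · rw [partialOne, if_pos h0]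
      field_simp
    · rw [partialTwo, if_pos h0]
      field_simp
  · have h1 : ¬(((1 + u₁ ^ 2 + u₂ ^ 2) / u - (mt ^ 2 + ms ^ 2) * u) / 2 = 0
        ∧ mt * u₂ - ms * u₁ = 0) := fun h1 => h h0 ⟨h1.2, by
      have := h1.1
      field_simp at this
      linarith⟩
    obtain ⟨α, B, hα, hB, hc, hn⟩ := exists_polar h1
    obtain ⟨t₁, t₂, rfl, hU⟩ := exists_of_invariants h0 hu hc hn
    exact ⟨t₁, t₂, α, hB, hα, hU⟩

lemma coordinates_mem {t₁ t₂ α : ℝ} (hα : 0 < α) (h0 : ¬(ms = 0 ∧ mt = 0)) :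
    ¬(mt * partialTwo ms mt t₁ t₂ α - ms * partialOne ms mt t₁ t₂ α = 0 ∧
      1 + partialOne ms mt t₁ t₂ α ^ 2 + partialTwo ms mt t₁ t₂ α ^ 2
        = (mt ^ 2 + ms ^ 2) * U ms mt t₁ t₂ α ^ 2) := by
  rintro ⟨h1, h2⟩
  obtain ⟨hc, hn, -⟩ := generic_invariants h0 t₁ t₂ α
  have hu := (U_pos (t₁ := t₁) (t₂ := t₂) (α := α) fun h => absurd h h0).ne'
  rw [h1] at hn
  rw [h2, show (mt ^ 2 + ms ^ 2) * U ms mt t₁ t₂ α ^ 2 / U ms mt t₁ t₂ α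
    = (mt ^ 2 + ms ^ 2) * U ms mt t₁ t₂ α by field_simp, sub_self, zero_div] at hc
  have := Real.cos_sq_add_sin_sq (mt * t₂ - ms * t₁)
  rw [(mul_eq_zero.1 hc).resolve_left hα.ne', (mul_eq_zero.1 hn).resolve_left hα.ne'] at this
  simp at this

lemma coordinates_unique {t₁ t₂ α t₁' t₂' α' : ℝ} (hα : 0 < α) (hα' : 0 < α')
    (ht : (t₁, t₂) ∈ band ms mt) (ht' : (t₁', t₂') ∈ band ms mt)
    (hu : U ms mt t₁ t₂ α = U ms mt t₁' t₂' α')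
    (hu₁ : partialOne ms mt t₁ t₂ α = partialOne ms mt t₁' t₂' α')
    (hu₂ : partialTwo ms mt t₁ t₂ α = partialTwo ms mt t₁' t₂' α') :
    t₁ = t₁' ∧ t₂ = t₂' ∧ α = α' := by
  by_cases h0 : ms = 0 ∧ mt = 0
  · have hpos := U_pos (t₁ := t₁) (t₂ := t₂) (α := α) fun _ : ms = 0 ∧ mt = 0 => hα
    have e1 := U_mul_companion (t₁ := t₁) (t₂ := t₂) (α := α) fun _ : ms = 0 ∧ mt = 0 => hα
    have e2 := U_mul_companion (t₁ := t₁') (t₂ := t₂') (α := α') fun _ : ms = 0 ∧ mt = 0 => hα'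
    rw [← hu, ← hu₁, ← hu₂, ← e1] at e2
    have e3 := mul_left_cancel₀ hpos.ne' e2
    simp only [companion, partialOne, partialTwo, if_pos h0] at e3 hu₁ hu₂
    obtain rfl : α' = α := by linarith
    exact ⟨mul_left_cancel₀ hα.ne' hu₁, mul_left_cancel₀ hα.ne' hu₂, rfl⟩
  · have hN := (sq_add_sq_pos h0).ne'
    obtain ⟨hc, hn, hs⟩ := generic_invariants h0 t₁ t₂ α
    obtain ⟨hc', hn', hs'⟩ := generic_invariants h0 t₁' t₂' α'
    rw [hu, hu₁, hu₂, ← hc'] at hc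
    rw [hu₁, hu₂, ← hn'] at hn
    rw [hu₁, hu₂, ← hs'] at hs
    obtain ⟨rfl, hB⟩ := polar_unique hα hα' ht ht' hc hn
    have hA : mt * t₁ + ms * t₂ = mt * t₁' + ms * t₂' :=
      Real.sinh_injective (mul_left_cancel₀ (Real.sqrt_pos.2 (radicand_pos h0 α)).ne' hs)
    refine ⟨mul_left_cancel₀ hN ?_, mul_left_cancel₀ hN ?_, rfl⟩
    · linear_combination mt * hA - ms * hB
    · linear_combination ms * hA + mt * hB

end Core

section AssembleBij

variable {p : ℕ}

lemma assemble_injective {u u₁ u₂ u' u₁' u₂' : ℝ} {a φ a' φ' : Fin p → ℝ} (hu : 0 < u)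
    (hu' : 0 < u') (ha : ∀ i, 0 < a i) (ha' : ∀ i, 0 < a' i) (hs : ∑ i, a i ^ 2 = 1)
    (hs' : ∑ i, a' i ^ 2 = 1) (hφ : ∀ i, φ i ∈ Ico (-Real.pi) Real.pi)
    (hφ' : ∀ i, φ' i ∈ Ico (-Real.pi) Real.pi)
    (h : assemble u u₁ u₂ a φ = assemble u' u₁' u₂' a' φ') :
    u = u' ∧ u₁ = u₁' ∧ u₂ = u₂' ∧ a = a' ∧ φ = φ' := by
  have hr := congrArg axialSq h
  -- The distance to the axis recovers u; each coordinate plane then gives a_i and φ_i as polar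
  -- coordinates.
  rw [axialSq_assemble _ _ _ _ hs, axialSq_assemble _ _ _ _ hs'] at hr
  obtain rfl : u = u' := by
    refine (sq_eq_sq₀ hu.le hu'.le).1 ?_
    field_simp at hr
    exact hr.symm
  have h0 := congrArg (fun y => y (Sum.inl 0)) h
  have h1 := congrArg (fun y => y (Sum.inl 1)) h
  simp only [assemble_inl_zero, assemble_inl_one] at h0 h1
  have hp : ∀ i, a i / u = a' i / u ∧ φ i = φ' i := fun i =>
    polar_unique (div_pos (ha i) hu) (div_pos (ha' i) hu) (hφ i) (hφ' i)
      (congrArg (fun y => y (Sum.inr (i, 0))) h) (congrArg (fun y => y (Sum.inr (i, 1))) h)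
  refine ⟨rfl, ?_, ?_, funext fun i => ?_, funext fun i => (hp i).2⟩
  · field_simp at h0
    linarith
  · field_simp at h1
    exact h1
  · have := (hp i).1
    field_simp at this
    exact this

lemma exists_assemble (hp : 1 ≤ p) (y : EvenSpace p) (hy : ∀ i, eta i y ≠ 0) :
    ∃ (u u₁ u₂ : ℝ) (a φ : Fin p → ℝ), 0 < u ∧ (∀ i, 0 < a i) ∧ ∑ i, a i ^ 2 = 1 ∧
      (∀ i, φ i ∈ Ico (-Real.pi) Real.pi) ∧ assemble u u₁ u₂ a φ = y := by
  choose r φ hr hφ hc hn using fun i => exists_polar fun h => hy i ((eta_eq_zero_iff i y).2 h)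
  have : Nonempty (Fin p) := ⟨⟨0, hp⟩⟩
  have hR : 0 < ∑ i, r i ^ 2 := Finset.sum_pos (fun i _ => pow_pos (hr i) 2) Finset.univ_nonempty
  have hR' := Real.sqrt_pos.2 hR
  have hsq := Real.sq_sqrt hR.le
  set R := √(∑ i, r i ^ 2)
  refine ⟨1 / R, -(y (Sum.inl 0)) / R, y (Sum.inl 1) / R, fun i => r i / R, φ, by positivity,
    fun i => div_pos (hr i) hR', ?_, hφ, ?_⟩
  · simp_rw [div_pow]
    rw [← Finset.sum_div, ← hsq, div_self (by positivity)]
  · refine evenSpace_ext ?_ ?_ (fun i => ?_) fun i => ?_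
    · rw [assemble_inl_zero]
      field_simp
    · rw [assemble_inl_one]
      field_simp
    · rw [assemble_inr_zero, ← hc i]
      field_simp
    · rw [assemble_inr_one, ← hn i]
      field_simp

lemma eta_assemble_ne_zero {u u₁ u₂ : ℝ} {a φ : Fin p → ℝ} (hu : 0 < u) {i : Fin p}
    (ha : 0 < a i) : eta i (assemble u u₁ u₂ a φ) ≠ 0 := by
  rw [Ne, eta_eq_zero_iff, assemble_inr_zero, assemble_inr_one]
  rintro ⟨h1, h2⟩
  have h3 := div_pos ha hu
  have := Real.cos_sq_add_sin_sq (φ i)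
  rw [(mul_eq_zero.1 h1).resolve_left h3.ne', (mul_eq_zero.1 h2).resolve_left h3.ne'] at this
  simp at this

end AssembleBij

/-! ### The limit of U as μ_s, μ_t → 0 -/

section Limit

/-- Split N·U = (β - α) cosh A + α((cosh A - 1) + (1 - cos B)). Then use β - α = N/(β + α), the
half-argument formulas, and A² + B² = N(t₁² + t₂²). The `dslope` terms are sinh x/x and sin x/x,
continuous at 0 with value 1. -/
lemma UGeneric_eq {ms mt : ℝ} (h0 : ¬(ms = 0 ∧ mt = 0)) (t₁ t₂ : ℝ) {α : ℝ} (hα : 0 < α) :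
    UGeneric ms mt t₁ t₂ α
      = Real.cosh (mt * t₁ + ms * t₂) / (√(α ^ 2 + mt ^ 2 + ms ^ 2) + α)
        + α / 2 * (t₁ ^ 2 + t₂ ^ 2)
        + α / 2 * ((mt * t₁ + ms * t₂) ^ 2 / (mt ^ 2 + ms ^ 2)
            * (dslope Real.sinh 0 ((mt * t₁ + ms * t₂) / 2) ^ 2 - 1)
          + (mt * t₂ - ms * t₁) ^ 2 / (mt ^ 2 + ms ^ 2)
            * (dslope Real.sin 0 ((mt * t₂ - ms * t₁) / 2) ^ 2 - 1)) := by
  have hN := sq_add_sq_pos h0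
  have hβ := Real.sq_sqrt (radicand_pos h0 α).le
  have hβ0 := Real.sqrt_pos.2 (radicand_pos h0 α)
  have h1 : Real.cosh (mt * t₁ + ms * t₂) - 1
      = (mt * t₁ + ms * t₂) ^ 2 / 2 * dslope Real.sinh 0 ((mt * t₁ + ms * t₂) / 2) ^ 2 := by
    have := sub_smul_dslope Real.sinh 0 ((mt * t₁ + ms * t₂) / 2)
    rw [sub_zero, Real.sinh_zero, sub_zero, smul_eq_mul] at this
    have h2 := Real.cosh_two_mul ((mt * t₁ + ms * t₂) / 2)
    rw [mul_div_cancel₀ _ (two_ne_zero' ℝ)] at h2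
    rw [h2, Real.cosh_sq, ← this]
    ring
  have h2 : 1 - Real.cos (mt * t₂ - ms * t₁)
      = (mt * t₂ - ms * t₁) ^ 2 / 2 * dslope Real.sin 0 ((mt * t₂ - ms * t₁) / 2) ^ 2 := by
    have := sub_smul_dslope Real.sin 0 ((mt * t₂ - ms * t₁) / 2)
    rw [sub_zero, Real.sin_zero, sub_zero, smul_eq_mul] at this
    have h2 := Real.cos_two_mul ((mt * t₂ - ms * t₁) / 2)
    rw [mul_div_cancel₀ _ (two_ne_zero' ℝ)] at h2
    rw [h2, Real.cos_sq', ← this]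
    ring
  have h3 : Real.cosh (mt * t₁ + ms * t₂) / (√(α ^ 2 + mt ^ 2 + ms ^ 2) + α)
      = (√(α ^ 2 + mt ^ 2 + ms ^ 2) - α) * Real.cosh (mt * t₁ + ms * t₂)
        / (mt ^ 2 + ms ^ 2) := by
    rw [div_eq_div_iff (by positivity) hN.ne']
    linear_combination -Real.cosh (mt * t₁ + ms * t₂) * hβ
  rw [h3, UGeneric]
  have hs : (mt * t₁ + ms * t₂) ^ 2 + (mt * t₂ - ms * t₁) ^ 2
      = (mt ^ 2 + ms ^ 2) * (t₁ ^ 2 + t₂ ^ 2) := by ring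
  field_simp
  linear_combination 2 * α * (h1 + h2) + α * hs

/-- A²/N and B²/N need not converge at the origin, as they depend on the direction, but they are
bounded and multiply factors tending to 0. With division by zero equal to 0, N = 0 needs no
exception. -/
lemma sq_div_mul_le {x N T : ℝ} (k : ℝ) (hN : 0 ≤ N) (hT : 0 ≤ T) (h : x ^ 2 ≤ N * T) :
    ‖x ^ 2 / N * k‖ ≤ T * ‖k‖ := by
  rw [norm_mul]
  refine mul_le_mul_of_nonneg_right ?_ (norm_nonneg _)
  rw [Real.norm_eq_abs, abs_of_nonneg (by positivity)]
  exact div_le_of_le_mul₀ hN hT (by linarith)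

lemma tendsto_UGeneric (t₁ t₂ : ℝ) {α : ℝ} (hα : 0 < α) :
    Tendsto (fun m : ℝ × ℝ => UGeneric m.1 m.2 t₁ t₂ α) (𝓝[≠] (0, 0))
      (𝓝 (ULimit t₁ t₂ α)) := by
  have hA : Continuous fun m : ℝ × ℝ => m.2 * t₁ + m.1 * t₂ := by fun_prop
  have hB : Continuous fun m : ℝ × ℝ => m.2 * t₂ - m.1 * t₁ := by fun_prop
  have e1 : Tendsto (fun m : ℝ × ℝ => Real.cosh (m.2 * t₁ + m.1 * t₂)
      / (√(α ^ 2 + m.2 ^ 2 + m.1 ^ 2) + α)) (𝓝 (0, 0)) (𝓝 (1 / (2 * α))) := by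
    have hc : ContinuousAt (fun m : ℝ × ℝ => Real.cosh (m.2 * t₁ + m.1 * t₂)
        / (√(α ^ 2 + m.2 ^ 2 + m.1 ^ 2) + α)) (0, 0) :=
      ContinuousAt.div (by fun_prop) (by fun_prop) (by positivity)
    have := hc.tendsto
    simp only [zero_mul, add_zero, Real.cosh_zero, zero_pow two_ne_zero,
      Real.sqrt_sq hα.le] at this
    rwa [← two_mul] at this
  have hsinh : ContinuousAt (dslope Real.sinh 0) 0 :=
    continuousAt_dslope_same.2 Real.differentiable_sinh.differentiableAt
  have hsin : ContinuousAt (dslope Real.sin 0) 0 :=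
    continuousAt_dslope_same.2 Real.differentiable_sin.differentiableAt
  have k1 : Tendsto (fun m : ℝ × ℝ => dslope Real.sinh 0 ((m.2 * t₁ + m.1 * t₂) / 2) ^ 2 - 1)
      (𝓝 (0, 0)) (𝓝 0) := by
    have h1 : Tendsto (fun m : ℝ × ℝ => (m.2 * t₁ + m.1 * t₂) / 2) (𝓝 (0, 0)) (𝓝 0) := by
      simpa using (hA.div_const 2).tendsto (0, 0)
    have h2 := ((hsinh.tendsto.comp h1).pow 2).sub_const 1
    simpa using h2
  have k2 : Tendsto (fun m : ℝ × ℝ => dslope Real.sin 0 ((m.2 * t₂ - m.1 * t₁) / 2) ^ 2 - 1)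
      (𝓝 (0, 0)) (𝓝 0) := by
    have h1 : Tendsto (fun m : ℝ × ℝ => (m.2 * t₂ - m.1 * t₁) / 2) (𝓝 (0, 0)) (𝓝 0) := by
      simpa using (hB.div_const 2).tendsto (0, 0)
    have h2 := ((hsin.tendsto.comp h1).pow 2).sub_const 1
    simpa using h2
  have r1 : Tendsto (fun m : ℝ × ℝ => (m.2 * t₁ + m.1 * t₂) ^ 2 / (m.2 ^ 2 + m.1 ^ 2)
      * (dslope Real.sinh 0 ((m.2 * t₁ + m.1 * t₂) / 2) ^ 2 - 1)) (𝓝 (0, 0)) (𝓝 0) := by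
    refine squeeze_zero_norm (fun m => sq_div_mul_le (T := t₁ ^ 2 + t₂ ^ 2) _ (by positivity)
      (by positivity) ?_) (by simpa using k1.norm.const_mul (t₁ ^ 2 + t₂ ^ 2))
    nlinarith [sq_nonneg (m.2 * t₂ - m.1 * t₁)]
  have r2 : Tendsto (fun m : ℝ × ℝ => (m.2 * t₂ - m.1 * t₁) ^ 2 / (m.2 ^ 2 + m.1 ^ 2)
      * (dslope Real.sin 0 ((m.2 * t₂ - m.1 * t₁) / 2) ^ 2 - 1)) (𝓝 (0, 0)) (𝓝 0) := by
    refine squeeze_zero_norm (fun m => sq_div_mul_le (T := t₁ ^ 2 + t₂ ^ 2) _ (by positivity)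
      (by positivity) ?_) (by simpa using k2.norm.const_mul (t₁ ^ 2 + t₂ ^ 2))
    nlinarith [sq_nonneg (m.2 * t₁ + m.1 * t₂)]
  have hsum := (e1.add_const (α / 2 * (t₁ ^ 2 + t₂ ^ 2))).add ((r1.add r2).const_mul (α / 2))
  have hlim : 1 / (2 * α) + α / 2 * (t₁ ^ 2 + t₂ ^ 2) + α / 2 * (0 + 0) = ULimit t₁ t₂ α := by
    rw [ULimit]
    ring
  rw [hlim] at hsum
  refine (hsum.mono_left nhdsWithin_le_nhds).congr' ?_
  filter_upwards [self_mem_nhdsWithin] with m hm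
  exact (UGeneric_eq (fun h => hm (Prod.ext h.1 h.2)) t₁ t₂ hα).symm

end Limit

/-! ### The region covered and its maximality in even dimension -/

section EvenDomain

variable {p : ℕ} {σ τ ms mt : ℝ}

lemma axialSq_pos {k : ℕ} {y : EuclideanSpace ℝ (Fin k ⊕ Fin p × Fin 2)} {i : Fin p}
    (hy : eta i y ≠ 0) : 0 < y (Sum.inr (i, 0)) ^ 2 + y (Sum.inr (i, 1)) ^ 2 := by
  rw [Ne, eta_eq_zero_iff] at hy
  rcases not_and_or.1 hy with h | h <;> positivity

/-- The (x_i, y_i)-components are ms z₁ + mt z₂ times x_i, y_i, which gives the first equation off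
the axis. The combination of the z-components with weights ms, mt then gives the second. -/
lemma rotation_eq_zero_iff (hσ : ms ^ 2 - mt ^ 2 = σ) (hτ : 2 * ms * mt = τ)
    (h0 : ¬(ms = 0 ∧ mt = 0)) {y : EvenSpace p} {i : Fin p} (hy : eta i y ≠ 0) :
    ms • xiEven σ τ y - mt • xiStarEven σ τ y = 0 ↔
      ms * y (Sum.inl 0) + mt * y (Sum.inl 1) = 0 ∧
        y (Sum.inl 0) ^ 2 + y (Sum.inl 1) ^ 2 + axialSq y = mt ^ 2 + ms ^ 2 := by
  have hpos := axialSq_pos hy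
  have hN := sq_add_sq_pos h0
  constructor
  · intro h
    have c0 := congrArg (fun w => w (Sum.inl 0)) h
    have c1 := congrArg (fun w => w (Sum.inl 1)) h
    have c2 := congrArg (fun w => w (Sum.inr (i, 0))) h
    have c3 := congrArg (fun w => w (Sum.inr (i, 1))) h
    simp only [PiLp.sub_apply, PiLp.smul_apply, smul_eq_mul, xiEven_inl_zero, xiEven_inl_one,
      xiEven_inr, xiStarEven_inl_zero, xiStarEven_inl_one, xiStarEven_inr,
      PiLp.zero_apply] at c0 c1 c2 c3
    have h1 : ms * y (Sum.inl 0) + mt * y (Sum.inl 1) = 0 := by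
      refine (mul_eq_zero.1 ?_).resolve_right hpos.ne'
      linear_combination y (Sum.inr (i, 0)) * c2 + y (Sum.inr (i, 1)) * c3
    refine ⟨h1, mul_left_cancel₀ hN.ne' ?_⟩
    subst hσ hτ
    linear_combination -2 * ms * c0 - 2 * mt * c1
      + (2 * ms * y (Sum.inl 0) + 2 * mt * y (Sum.inl 1)) * h1
  · rintro ⟨h1, h2⟩
    subst hσ hτ
    refine evenSpace_ext ?_ ?_ (fun j => ?_) fun j => ?_ <;>
    simp only [PiLp.sub_apply, PiLp.smul_apply, smul_eq_mul, xiEven_inl_zero, xiEven_inl_one,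
      xiEven_inr, xiStarEven_inl_zero, xiStarEven_inl_one, xiStarEven_inr,
      PiLp.zero_apply]
    · linear_combination y (Sum.inl 0) * h1 - ms / 2 * h2
    · linear_combination y (Sum.inl 1) * h1 - mt / 2 * h2
    · linear_combination y (Sum.inr (j, 0)) * h1
    · linear_combination y (Sum.inr (j, 1)) * h1

lemma rotation_assemble_eq_zero_iff (hσ : ms ^ 2 - mt ^ 2 = σ) (hτ : 2 * ms * mt = τ)
    (h0 : ¬(ms = 0 ∧ mt = 0)) {u u₁ u₂ : ℝ} {a φ : Fin p → ℝ} (hu : 0 < u)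
    (ha : ∀ i, 0 < a i) (hs : ∑ i, a i ^ 2 = 1) (i : Fin p) :
    ms • xiEven σ τ (assemble u u₁ u₂ a φ) - mt • xiStarEven σ τ (assemble u u₁ u₂ a φ) = 0 ↔
      mt * u₂ - ms * u₁ = 0 ∧ 1 + u₁ ^ 2 + u₂ ^ 2 = (mt ^ 2 + ms ^ 2) * u ^ 2 := by
  rw [rotation_eq_zero_iff hσ hτ h0 (eta_assemble_ne_zero hu (ha i)),
    axialSq_assemble _ _ _ _ hs, assemble_inl_zero, assemble_inl_one]
  refine and_congr ⟨fun h => ?_, fun h => ?_⟩ ⟨fun h => ?_, fun h => ?_⟩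
  · field_simp at h
    linarith
  · field_simp
    linarith
  · field_simp at h
    linarith
  · field_simp
    linarith

lemma mem_evenDomain_iff {y : EvenSpace p} : y ∈ evenDomain p σ τ ↔ (∀ i, eta i y ≠ 0) ∧
    (¬(muS σ τ = 0 ∧ muT σ τ = 0) →
      muS σ τ • xiEven σ τ y - muT σ τ • xiStarEven σ τ y ≠ 0) := by
  unfold evenDomain
  split_ifs with h <;> simp [h, zeroSet]

lemma bijOn_evenMap (hp : 1 ≤ p) (hτ : 0 ≤ τ) :
    BijOn (evenMap (muS σ τ) (muT σ τ)) (evenRange p (muS σ τ) (muT σ τ))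
      (evenDomain p σ τ) := by
  have i0 : Fin p := ⟨0, hp⟩
  have hσ := muS_sq_sub_muT_sq σ τ
  have hτ := two_mul_muS_mul_muT σ τ hτ
  refine ⟨?_, ?_, ?_⟩
  · rintro q ⟨-, hα, ha, hs, -⟩
    rw [evenMap, evenChart_eq, mem_evenDomain_iff]
    refine ⟨fun i => eta_assemble_ne_zero (U_pos fun _ => hα) (ha i), fun h0 => ?_⟩
    rw [Ne, rotation_assemble_eq_zero_iff hσ hτ h0 (U_pos fun _ => hα) ha hs i0]
    exact coordinates_mem hα h0
  · rintro ⟨t₁, t₂, α, a, φ⟩ ⟨hb, hα, ha, hs, hφ⟩ ⟨t₁', t₂', α', a', φ'⟩ ⟨hb', hα', ha', hs', hφ'⟩ h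
    rw [evenMap, evenMap, evenChart_eq, evenChart_eq] at h
    obtain ⟨hu, hu₁, hu₂, rfl, rfl⟩ := assemble_injective (U_pos fun _ => hα) (U_pos fun _ => hα')
      ha ha' hs hs' hφ hφ' h
    obtain ⟨rfl, rfl, rfl⟩ := coordinates_unique hα hα' hb hb' hu hu₁ hu₂
    rfl
  · intro y hy
    rw [mem_evenDomain_iff] at hy
    obtain ⟨u, u₁, u₂, a, φ, hu, ha, hs, hφ, rfl⟩ := exists_assemble hp y hy.1
    obtain ⟨t₁, t₂, α, hb, hα, e, e₁, e₂⟩ := exists_coordinates (ms := muS σ τ) (mt := muT σ τ)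
      (u₁ := u₁) (u₂ := u₂) hu fun h0 h =>
        hy.2 h0 ((rotation_assemble_eq_zero_iff hσ hτ h0 hu ha hs i0).2 h)
    refine ⟨(t₁, t₂, α, a, φ), ⟨hb, hα, ha, hs, hφ⟩, ?_⟩
    rw [evenMap, evenChart_eq, e, e₁, e₂]

lemma evenDomain_eq (hp : 1 ≤ p) (hτ : 0 ≤ τ) : evenDomain p σ τ = {y | LinearIndependent ℝ
    (Sum.elim ![xiEven σ τ y, xiStarEven σ τ y] fun i : Fin p => eta i y)} := by
  have hσ := muS_sq_sub_muT_sq σ τ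
  have hτ := two_mul_muS_mul_muT σ τ hτ
  ext y
  rw [mem_evenDomain_iff, mem_ofPred_eq]
  constructor
  · rintro ⟨hy, hrot⟩
    have hpos := axialSq_pos (hy ⟨0, hp⟩)
    have hax : 0 < axialSq y := lt_of_lt_of_le hpos <|
      Finset.single_le_sum (f := fun i : Fin p => y (Sum.inr (i, 0)) ^ 2 + y (Sum.inr (i, 1)) ^ 2)
        (fun i _ => by positivity) (Finset.mem_univ (⟨0, hp⟩ : Fin p))
    rw [Fintype.linearIndependent_iff]
    intro g hg
    set c := g (Sum.inl 0) with hc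
    set d := g (Sum.inl 1) with hd
    have comp : ∀ A, c * xiEven σ τ y A + d * xiStarEven σ τ y A
        + ∑ i, g (Sum.inr i) * eta i y A = 0 := fun A => by
      have := congrArg (fun w => w A) hg
      simpa [Fintype.sum_sum_type] using this
    have c0 := comp (Sum.inl 0)
    have c1 := comp (Sum.inl 1)
    have c2 := fun j => comp (Sum.inr (j, 0))
    have c3 := fun j => comp (Sum.inr (j, 1))
    simp only [xiEven_inl_zero, xiEven_inl_one, xiStarEven_inl_zero, xiStarEven_inl_one, eta_inl,
      mul_zero, Finset.sum_const_zero, add_zero] at c0 c1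
    simp only [xiEven_inr, xiStarEven_inr, eta_inr_zero, mul_ite, mul_zero, Finset.sum_ite_eq,
      Finset.mem_univ, if_true] at c2
    simp only [xiEven_inr, xiStarEven_inr, eta_inr_one, mul_ite, mul_zero, Finset.sum_ite_eq,
      Finset.mem_univ, if_true] at c3
    -- In the plane of (x_j, y_j) the fields ξ̃, ξ̃⋆ are radial and η_j is tangential, so the two
    -- parts of the relation vanish separately.
    have hg' : ∀ j, g (Sum.inr j) = 0 := fun j => by
      refine (mul_eq_zero.1 ?_).resolve_right (axialSq_pos (hy j)).ne'
      linear_combination y (Sum.inr (j, 0)) * c3 j - y (Sum.inr (j, 1)) * c2 j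
    have hz : c * y (Sum.inl 0) - d * y (Sum.inl 1) = 0 := by
      refine (mul_eq_zero.1 ?_).resolve_right hpos.ne'
      linear_combination y (Sum.inr (⟨0, hp⟩, 0)) * c2 ⟨0, hp⟩
        + y (Sum.inr (⟨0, hp⟩, 1)) * c3 ⟨0, hp⟩
    suffices h : c = 0 ∧ d = 0 by
      rintro (j | j)
      · fin_cases j
        · exact h.1
        · exact h.2
      · exact hg' j
    set K := y (Sum.inl 0) ^ 2 + y (Sum.inl 1) ^ 2 + axialSq y with hK
    have hKpos : 0 < K := by positivity
    -- Modulo `hz` the z-components form a homogeneous 2 × 2 system in (c, d), with determinant σ² +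
    -- τ² - K² up to sign; `f0` and `f1` are Cramer's rule.
    have e0 : c * (σ - K) = d * τ := by
      linear_combination 2 * c0 - 2 * y (Sum.inl 0) * hz + c * hK
    have e1 : c * τ + d * (σ + K) = 0 := by
      linear_combination 2 * c1 - 2 * y (Sum.inl 1) * hz + d * hK
    have f0 : c * (σ ^ 2 + τ ^ 2 - K ^ 2) = 0 := by linear_combination (σ + K) * e0 + τ * e1
    have f1 : d * (σ ^ 2 + τ ^ 2 - K ^ 2) = 0 := by linear_combination (σ - K) * e1 - τ * e0
    -- Since (μ_t² + μ_s²)² = σ² + τ² and K > 0, this is exactly the singular case. There (c, d) is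
    -- a multiple of (μ_s, -μ_t) by `e2`, and `hz` excludes a nonzero multiple unless the rotation
    -- field vanishes.
    by_cases hKN : K = muT σ τ ^ 2 + muS σ τ ^ 2
    · have h0 : ¬(muS σ τ = 0 ∧ muT σ τ = 0) := fun h0 => by
        rw [h0.1, h0.2] at hKN
        simp [hKN] at hKpos
      have hne : muS σ τ * y (Sum.inl 0) + muT σ τ * y (Sum.inl 1) ≠ 0 := fun h =>
        hrot h0 ((rotation_eq_zero_iff hσ hτ h0 (hy ⟨0, hp⟩)).2 ⟨h, hKN⟩)
      have e2 : c * muT σ τ + d * muS σ τ = 0 := by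
        refine (mul_eq_zero.1 ?_).resolve_left (sq_add_sq_pos h0).ne'
        linear_combination -muT σ τ / 2 * e0 + muS σ τ / 2 * e1
          + (muS σ τ * d - muT σ τ * c) / 2 * hσ + (muT σ τ * d + muS σ τ * c) / 2 * hτ
          - (muT σ τ * c + muS σ τ * d) / 2 * hKN
      constructor
      · refine (mul_eq_zero.1 ?_).resolve_right hne
        linear_combination muS σ τ * hz + y (Sum.inl 1) * e2
      · refine (mul_eq_zero.1 ?_).resolve_right hne
        linear_combination y (Sum.inl 0) * e2 - muT σ τ * hz
    · have hne : σ ^ 2 + τ ^ 2 - K ^ 2 ≠ 0 := fun h => hKN <| by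
        refine (sq_eq_sq₀ hKpos.le (by positivity)).1 ?_
        linear_combination -h - (σ + muS σ τ ^ 2 - muT σ τ ^ 2) * hσ
          - (τ + 2 * muS σ τ * muT σ τ) * hτ
      exact ⟨(mul_eq_zero.1 f0).resolve_right hne, (mul_eq_zero.1 f1).resolve_right hne⟩
  · intro h
    refine ⟨fun i => h.ne_zero (Sum.inr i), fun h0 hrot => h0 ?_⟩
    have := Fintype.linearIndependent_iff.1 h
      (Sum.elim ![muS σ τ, -muT σ τ] 0) (by simpa [Fintype.sum_sum_type, sub_eq_add_neg] using hrot)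
    exact ⟨by simpa using this (Sum.inl 0), by simpa using this (Sum.inl 1)⟩

end EvenDomain

/-! ### Odd dimension as the slice t₂ = 0 -/

section Odd

variable {p : ℕ} {σ : ℝ}

/-- The hyperplane embedding as a linear isometry. -/
def hyperplaneIsometry (p : ℕ) : OddSpace p →ₗᵢ[ℝ] EvenSpace p where
  toFun := hyperplane
  map_add' x y := evenSpace_ext rfl (by simp) (fun _ => rfl) fun _ => rfl
  map_smul' c x := evenSpace_ext rfl (by simp) (fun _ => rfl) fun _ => rfl
  norm_map' x := by
    refine (sq_eq_sq₀ (norm_nonneg _) (norm_nonneg _)).1 ?_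
    simp [EuclideanSpace.norm_sq_eq, Fintype.sum_sum_type]

/-- The projection forgetting the coordinate `z₂`. -/
def oddProj (p : ℕ) : EvenSpace p →L[ℝ] OddSpace p :=
  LinearMap.toContinuousLinearMap
    { toFun := fun y => WithLp.toLp 2 (Sum.elim (fun _ => y (Sum.inl 0)) fun k => y (Sum.inr k))
      map_add' := fun x y => by
        ext (j | k) <;> rfl
      map_smul' := fun c x => by
        ext (j | k) <;> rfl }

@[simp] lemma oddProj_inl (y : EvenSpace p) (j : Fin 1) :
    oddProj p y (Sum.inl j) = y (Sum.inl 0) := rfl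

@[simp] lemma oddProj_inr (y : EvenSpace p) (k : Fin p × Fin 2) :
    oddProj p y (Sum.inr k) = y (Sum.inr k) := rfl

lemma oddChart_eq (t₁ α : ℝ) (a φ : Fin p → ℝ) :
    oddChart σ t₁ α a φ = oddProj p (evenChart (muS σ 0) (muT σ 0) t₁ 0 α a φ) := rfl

lemma hyperplane_oddProj {y : EvenSpace p} (hy : y (Sum.inl 1) = 0) :
    hyperplane (oddProj p y) = y :=
  evenSpace_ext rfl hy.symm (fun _ => rfl) fun _ => rfl

lemma axialSq_oddProj (y : EvenSpace p) : axialSq (oddProj p y) = axialSq y := rfl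

lemma eta_oddProj (i : Fin p) (y : EvenSpace p) : eta i (oddProj p y) = oddProj p (eta i y) := by
  ext (j | ⟨k, j⟩)
  · simp
  · fin_cases j <;> simp

/-- For τ = 0 the field ξ̃ is tangent to z₂ = 0, so the projection loses nothing there. -/
lemma xiOdd_oddProj {y : EvenSpace p} (hy : y (Sum.inl 1) = 0) :
    xiOdd σ (oddProj p y) = oddProj p (xiEven σ 0 y) := by
  ext (j | k)
  · simp [hy, axialSq_oddProj]
  · simp

lemma partialTwo_eq_zero {ms mt : ℝ} (h : ms = 0 ∨ mt = 0) (t₁ α : ℝ) :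
    partialTwo ms mt t₁ 0 α = 0 := by
  rcases h with rfl | rfl <;> simp [partialTwo]

lemma muS_eq_zero_or_muT_eq_zero (σ : ℝ) : muS σ 0 = 0 ∨ muT σ 0 = 0 := by
  rcases le_total 0 σ with h | h
  · exact Or.inr (muT_of_nonneg h)
  · exact Or.inl (muS_of_nonpos h)

lemma evenChart_inl_one (t₁ α : ℝ) (a φ : Fin p → ℝ) :
    evenChart (muS σ 0) (muT σ 0) t₁ 0 α a φ (Sum.inl 1) = 0 := by
  rw [evenChart_eq, assemble_inl_one, partialTwo_eq_zero (muS_eq_zero_or_muT_eq_zero σ), zero_div]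

lemma hyperplane_oddChart (t₁ α : ℝ) (a φ : Fin p → ℝ) :
    hyperplane (oddChart σ t₁ α a φ) = evenChart (muS σ 0) (muT σ 0) t₁ 0 α a φ :=
  hyperplane_oddProj (evenChart_inl_one ..)

lemma pos_of_mem_alphaRange {α : ℝ} (h : α ∈ alphaRange σ) (hσ : 0 ≤ σ) : 0 < α := by
  rwa [alphaRange, if_neg hσ.not_gt] at h

lemma alphaRange_regular {α : ℝ} (h : α ∈ alphaRange σ) : muS σ 0 = 0 ∧ muT σ 0 = 0 → 0 < α := by
  rintro ⟨h1, h2⟩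
  refine pos_of_mem_alphaRange h ?_
  have := muS_sq_sub_muT_sq σ 0
  rw [h1, h2] at this
  linarith

lemma U_eq_UOdd (t₁ α : ℝ) : U (muS σ 0) (muT σ 0) t₁ 0 α = UOdd σ t₁ α := by
  rcases lt_trichotomy σ 0 with h | rfl | h
  · have h1 := Real.sqrt_pos.2 (neg_pos.2 h)
    have h2 := Real.sq_sqrt (neg_pos.2 h).le
    rw [UOdd, if_neg h.not_gt, if_pos h, muS_of_nonpos h.le, muT_of_nonpos h.le, U,
      if_neg (by simp [h1.ne']), UGeneric, h2]
    simp [sub_eq_add_neg]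
    ring
  · simp [UOdd, U, ULimit, muS_of_nonneg, muT_of_nonneg]
    ring
  · have h1 := Real.sqrt_pos.2 h
    have h2 := Real.sq_sqrt h.le
    rw [UOdd, if_pos h, muS_of_nonneg h.le, muT_of_nonneg h.le, U,
      if_neg (by simp [h1.ne']), UGeneric, h2]
    simp
    ring

lemma evenMetric_eq_oddMetric (t₁ α : ℝ) (a : Fin p → ℝ) (v : OddParam p) :
    evenMetric (muS σ 0) (muT σ 0) t₁ 0 α a (v.1, 0, v.2.1, v.2.2.1, v.2.2.2)
      = oddMetric σ t₁ α a v := by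
  rw [evenMetric, oddMetric, U_eq_UOdd, muS_sq, muT_sq]
  have hr : √(σ ^ 2 + 0 ^ 2) = |σ| := by rw [zero_pow two_ne_zero, add_zero, Real.sqrt_sq_eq_abs]
  rw [hr]
  rcases lt_trichotomy σ 0 with h | rfl | h
  · rw [Real.sign_of_neg h, abs_of_neg h]
    ring
  · simp
  · rw [Real.sign_of_pos h, abs_of_pos h]
    ring

lemma hasDerivAt_oddChart_one {t₁ α : ℝ} (h : α ∈ alphaRange σ) {a : Fin p → ℝ}
    (φ : Fin p → ℝ) (ha : ∑ i, a i ^ 2 = 1) :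
    HasDerivAt (fun s => oddChart σ s α a φ) (xiOdd σ (oddChart σ t₁ α a φ)) t₁ := by
  rw [oddChart_eq, xiOdd_oddProj (evenChart_inl_one ..)]
  exact (oddProj p).hasFDerivAt.comp_hasDerivAt t₁ (hasDerivAt_evenChart_one t₁ 0 φ
    (muS_sq_sub_muT_sq σ 0) (two_mul_muS_mul_muT σ 0 le_rfl) (alphaRange_regular h) ha)

lemma hasDerivAt_oddChart_angle {t₁ α : ℝ} (h : α ∈ alphaRange σ) {a : Fin p → ℝ}
    (φ : Fin p → ℝ) (i : Fin p) :
    HasDerivAt (fun s => oddChart σ t₁ α a (Function.update φ i s))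
      (eta i (oddChart σ t₁ α a φ)) (φ i) := by
  rw [oddChart_eq, eta_oddProj]
  exact (oddProj p).hasFDerivAt.comp_hasDerivAt (φ i)
    (hasDerivAt_evenChart_angle t₁ 0 φ (alphaRange_regular h) i)

/-- The inclusion of the parameters with `t₂ = 0`. -/
def oddInclusion (p : ℕ) : OddParam p →L[ℝ] EvenParam p :=
  (ContinuousLinearMap.fst ℝ _ _).prod
    ((0 : OddParam p →L[ℝ] ℝ).prod (ContinuousLinearMap.snd ℝ _ _))

lemma contDiffAt_oddMap {q : OddParam p} (h : q.2.1 ∈ alphaRange σ) :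
    ContDiffAt ℝ ∞ (oddMap (p := p) σ) q := by
  have h1 : ContDiffAt ℝ ∞ (evenMap (p := p) (muS σ 0) (muT σ 0)) (oddInclusion p q) :=
    contDiffAt_evenMap (alphaRange_regular h)
  exact (oddProj p).contDiff.contDiffAt.comp q (h1.comp q (oddInclusion p).contDiff.contDiffAt)

/-- The hyperplane embedding is a linear isometry and intertwines the odd chart with the even chart
on t₂ = 0, so the odd metric is a pull-back. -/
lemma norm_fderiv_oddMap {q : OddParam p} (h : q.2.1 ∈ alphaRange σ) (v : OddParam p) :
    ‖fderiv ℝ (oddMap σ) q v‖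
      = ‖fderiv ℝ (evenMap (muS σ 0) (muT σ 0)) (oddInclusion p q) (oddInclusion p v)‖ := by
  have h1 : HasFDerivAt (evenMap (p := p) (muS σ 0) (muT σ 0)) _ (oddInclusion p q) :=
    ((contDiffAt_evenMap (alphaRange_regular h)).differentiableAt (by simp)).hasFDerivAt
  have h2 : HasFDerivAt (oddMap (p := p) σ) _ q :=
    ((contDiffAt_oddMap h).differentiableAt (by simp)).hasFDerivAt
  have h3 := h1.comp q (oddInclusion p).hasFDerivAt
  have h4 := (hyperplaneIsometry p).toContinuousLinearMap.hasFDerivAt.comp q h2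
  have h5 : (hyperplaneIsometry p).toContinuousLinearMap ∘ oddMap σ
      = evenMap (muS σ 0) (muT σ 0) ∘ oddInclusion p := funext fun _ => hyperplane_oddChart ..
  rw [h5] at h4
  have h6 := congrArg (fun L => L v) (h4.unique h3)
  rw [← (hyperplaneIsometry p).norm_map]
  exact congrArg norm h6

lemma norm_fderiv_oddMap_sq {q : OddParam p} (h : q.2.1 ∈ alphaRange σ)
    (ha : ∑ i, q.2.2.1 i ^ 2 = 1) {v : OddParam p} (hv : ∑ i, q.2.2.1 i * v.2.2.1 i = 0) :
    ‖fderiv ℝ (oddMap σ) q v‖ ^ 2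
      = evenMetric (muS σ 0) (muT σ 0) q.1 0 q.2.1 q.2.2.1 (v.1, 0, v.2.1, v.2.2.1, v.2.2.2) := by
  rw [norm_fderiv_oddMap h]
  exact norm_fderiv_evenMap_sq (q := oddInclusion p q) (v := oddInclusion p v)
    (alphaRange_regular h) ha hv

lemma isLocalCoordinatesAt_oddMap {q : OddParam p} (h : q.2.1 ∈ alphaRange σ)
    (ha : ∀ i, 0 < q.2.2.1 i) (hq : ∑ i, q.2.2.1 i ^ 2 = 1) :
    IsLocalCoordinatesAt (oddConstraint p) (oddMap σ) q := by
  refine isLocalCoordinatesAt_of_injective (c := fun q : OddParam p => ∑ i, q.2.2.1 i ^ 2)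
    (contDiffAt_oddMap h) (by fun_prop) hq ?_ ?_
  · simp [Module.finrank_prod]
    ring
  · intro v hc hv
    have hav := sum_mul_eq_zero_of_fderiv
      ((ContinuousLinearMap.fst ℝ (Fin p → ℝ) (Fin p → ℝ)).comp
        ((ContinuousLinearMap.snd ℝ ℝ _).comp (ContinuousLinearMap.snd ℝ ℝ _))) q v hc
    have hm := norm_fderiv_oddMap_sq h hq hav
    rw [hv, norm_zero, zero_pow two_ne_zero] at hm
    obtain ⟨h1, h2, h3, h4⟩ := eq_zero_of_evenMetric (alphaRange_regular h) ha hm.symm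
    -- The coefficient of dt₁². For σ < 0 it stays positive at α = 0 because μ_t² = -σ > 0, which is
    -- why α may cross zero.
    have hpos : 0 < q.2.1 ^ 2 + muT σ 0 ^ 2 := by
      rcases lt_or_ge σ 0 with hσ | hσ
      · rw [muT_of_nonpos hσ.le, Real.sq_sqrt (neg_pos.2 hσ).le]
        nlinarith [sq_nonneg q.2.1]
      · have := pos_of_mem_alphaRange h hσ
        positivity
    have h5 : v.1 ^ 2 = 0 := by
      refine (mul_eq_zero.1 ?_).resolve_left hpos.ne'
      linear_combination h1
    exact Prod.ext (pow_eq_zero_iff two_ne_zero |>.1 h5) (Prod.ext h2 (Prod.ext h3 h4))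

lemma exists_oddCoordinates {u u₁ : ℝ} (hu : 0 < u)
    (h : 0 < σ → ¬(u₁ = 0 ∧ 1 = σ * u ^ 2)) :
    ∃ t₁ α : ℝ, (t₁, 0) ∈ band (muS σ 0) (muT σ 0) ∧ α ∈ alphaRange σ ∧
      U (muS σ 0) (muT σ 0) t₁ 0 α = u ∧ partialOne (muS σ 0) (muT σ 0) t₁ 0 α = u₁ := by
  rcases lt_or_ge σ 0 with hσ | hσ
  · have hT := Real.sqrt_pos.2 (neg_pos.2 hσ)
    rw [muS_of_nonpos hσ.le, muT_of_nonpos hσ.le]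
    -- For σ < 0 the slice has B = 0, so the invariant α cos B is α itself, with either sign; no
    -- point has to be excluded.
    obtain ⟨t₁, t₂, hB, e, e₁, -⟩ := exists_of_invariants (ms := 0) (mt := √(-σ)) (u := u)
      (u₁ := u₁) (u₂ := 0) (α := ((1 + u₁ ^ 2 + 0 ^ 2) / u - (√(-σ) ^ 2 + 0 ^ 2) * u) / 2) (B := 0)
      (by simp [hT.ne']) hu (by simp) (by simp)
    obtain rfl : t₂ = 0 := by simpa [hT.ne'] using hB
    exact ⟨t₁, _, by simp [band, Real.pi_pos, Real.pi_pos.le], by simp [alphaRange, hσ], e, e₁⟩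
  · have hS := Real.sq_sqrt hσ
    rw [muS_of_nonneg hσ, muT_of_nonneg hσ]
    obtain ⟨t₁, t₂, α, hb, hα, e, e₁, e₂⟩ := exists_coordinates (ms := √σ) (mt := 0) (u₁ := u₁)
      (u₂ := 0) hu fun h0 hc => by
        have hs : √σ ≠ 0 := fun hs => h0 ⟨hs, rfl⟩
        have hu₁ : u₁ = 0 := by simpa [hs] using hc.1
        refine h (lt_of_le_of_ne hσ fun h => hs (by simp [← h])) ⟨hu₁, ?_⟩
        have := hc.2
        rw [hu₁, hS] at this
        linarith
    -- With mt = 0 and √σ ≠ 0 the invariant β sinh(√σ t₂) equals √σ u₂ = 0; for σ = 0 one has u₂ = α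
    -- t₂.
    obtain rfl : t₂ = 0 := by
      by_cases hs : √σ = 0
      · rw [hs] at e₂
        simpa [partialTwo, hα.ne'] using e₂
      · have hβ := Real.sqrt_pos.2 (radicand_pos (ms := √σ) (mt := 0) (by simpa using hs) α)
        have := (generic_invariants (ms := √σ) (mt := 0) (by simpa using hs) t₁ t₂ α).2.2
        rw [e₂] at this
        simpa [hs, hβ.ne'] using (mul_eq_zero.1 (this.trans (by simp))).resolve_left hβ.ne'
    exact ⟨t₁, α, hb, by simpa [alphaRange, hσ.not_gt] using hα, e, e₁⟩

lemma oddCoordinates_unique {t₁ α t₁' α' : ℝ} (hα : α ∈ alphaRange σ) (hα' : α' ∈ alphaRange σ)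
    (ht : (t₁, 0) ∈ band (muS σ 0) (muT σ 0)) (ht' : (t₁', 0) ∈ band (muS σ 0) (muT σ 0))
    (hu : U (muS σ 0) (muT σ 0) t₁ 0 α = U (muS σ 0) (muT σ 0) t₁' 0 α')
    (hu₁ : partialOne (muS σ 0) (muT σ 0) t₁ 0 α = partialOne (muS σ 0) (muT σ 0) t₁' 0 α') :
    t₁ = t₁' ∧ α = α' := by
  have hu₂ : partialTwo (muS σ 0) (muT σ 0) t₁ 0 α = partialTwo (muS σ 0) (muT σ 0) t₁' 0 α' := by
    rw [partialTwo_eq_zero (muS_eq_zero_or_muT_eq_zero σ),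
      partialTwo_eq_zero (muS_eq_zero_or_muT_eq_zero σ)]
  rcases lt_or_ge σ 0 with hσ | hσ
  · have hT := Real.sqrt_pos.2 (neg_pos.2 hσ)
    rw [muS_of_nonpos hσ.le, muT_of_nonpos hσ.le] at hu hu₁ hu₂
    have h0 : ¬((0 : ℝ) = 0 ∧ √(-σ) = 0) := by simp [hT.ne']
    obtain ⟨hc, -, hs⟩ := generic_invariants h0 t₁ 0 α
    obtain ⟨hc', -, hs'⟩ := generic_invariants h0 t₁' 0 α'
    rw [hu, hu₁, hu₂, ← hc'] at hc
    rw [hu₁, hu₂, ← hs'] at hs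
    obtain rfl : α = α' := by simpa using hc
    have hA := Real.sinh_injective (mul_left_cancel₀ (Real.sqrt_pos.2 (radicand_pos h0 α)).ne' hs)
    exact ⟨by simpa [hT.ne'] using hA, rfl⟩
  · obtain ⟨h1, -, h3⟩ := coordinates_unique (pos_of_mem_alphaRange hα hσ)
      (pos_of_mem_alphaRange hα' hσ) ht ht' hu hu₁ hu₂
    exact ⟨h1, h3⟩

lemma eta_hyperplane_ne_zero_iff (i : Fin p) (y : OddSpace p) :
    eta i (hyperplane y) ≠ 0 ↔ eta i y ≠ 0 := by
  rw [Ne, Ne, eta_eq_zero_iff, eta_eq_zero_iff]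
  rfl

/-- Off the axis the (x_i, y_i)-components z₁ x_i, z₁ y_i force z₁ = 0. Since `axialSq y > 0` there,
zeros occur only for σ > 0. -/
lemma xiOdd_eq_zero_iff {i : Fin p} {y : OddSpace p} (hy : eta i y ≠ 0) :
    xiOdd σ y = 0 ↔ y (Sum.inl 0) = 0 ∧ axialSq y = σ := by
  have hpos := axialSq_pos hy
  constructor
  · intro h
    have c0 := congrArg (fun w => w (Sum.inl 0)) h
    have c2 := congrArg (fun w => w (Sum.inr (i, 0))) h
    have c3 := congrArg (fun w => w (Sum.inr (i, 1))) h
    simp only [xiOdd_inl, xiOdd_inr, PiLp.zero_apply] at c0 c2 c3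
    have hz : y (Sum.inl 0) = 0 := by
      refine (mul_eq_zero.1 ?_).resolve_right hpos.ne'
      linear_combination y (Sum.inr (i, 0)) * c2 + y (Sum.inr (i, 1)) * c3
    rw [hz] at c0
    exact ⟨hz, by linarith⟩
  · rintro ⟨hz, hs⟩
    ext (j | k)
    · simp [hz, hs]
    · simp [hz]

lemma mem_oddDomain_iff {y : OddSpace p} :
    y ∈ oddDomain p σ ↔ (∀ i, eta i y ≠ 0) ∧ xiOdd σ y ≠ 0 := by
  simp [oddDomain, zeroSet]

lemma hyperplane_oddMap (q : OddParam p) : hyperplane (oddMap σ q)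
    = assemble (U (muS σ 0) (muT σ 0) q.1 0 q.2.1) (partialOne (muS σ 0) (muT σ 0) q.1 0 q.2.1) 0
      q.2.2.1 q.2.2.2 := by
  rw [oddMap, hyperplane_oddChart, evenChart_eq,
    partialTwo_eq_zero (muS_eq_zero_or_muT_eq_zero σ)]

/-- Holds for all t₁ ∈ ℝ; the band matters only for injectivity. A zero of ξ̃ in the image would
force σ > 0 and α = 0. -/
lemma mapsTo_oddMap (hp : 1 ≤ p) : MapsTo (oddMap σ) (oddRange p σ) (oddDomain p σ) := by
  rintro q ⟨hα, ha, hs, -⟩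
  have hu := U_pos (t₁ := q.1) (t₂ := 0) (alphaRange_regular hα)
  have heta : ∀ i, eta i (oddMap σ q) ≠ 0 := fun i => by
    rw [← eta_hyperplane_ne_zero_iff, hyperplane_oddMap]
    exact eta_assemble_ne_zero hu (ha i)
  refine mem_oddDomain_iff.2 ⟨heta, ?_⟩
  rw [Ne, xiOdd_eq_zero_iff (heta ⟨0, hp⟩)]
  rintro ⟨h1, h2⟩
  have h1' : hyperplane (oddMap σ q) (Sum.inl 0) = 0 := h1
  have h2' : axialSq (hyperplane (oddMap σ q)) = σ := h2
  rw [hyperplane_oddMap, assemble_inl_zero] at h1'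
  rw [hyperplane_oddMap, axialSq_assemble _ _ _ _ hs] at h2'
  have hσ : 0 < σ := by
    rw [← h2']
    positivity
  have h0 : ¬(muS σ 0 = 0 ∧ muT σ 0 = 0) := by
    rw [muS_of_nonneg hσ.le]
    simp [(Real.sqrt_pos.2 hσ).ne']
  have h3 : partialOne (muS σ 0) (muT σ 0) q.1 0 q.2.1 = 0 := by
    simpa [hu.ne'] using h1'
  refine coordinates_mem (pos_of_mem_alphaRange hα hσ.le) h0 (t₁ := q.1) (t₂ := 0) ⟨?_, ?_⟩
  · rw [h3, muT_of_nonneg hσ.le]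
    ring
  · have hN : muT σ 0 ^ 2 + muS σ 0 ^ 2 = σ := by
      rw [muT_of_nonneg hσ.le, muS_of_nonneg hσ.le, Real.sq_sqrt hσ.le]
      ring
    rw [h3, partialTwo_eq_zero (muS_eq_zero_or_muT_eq_zero σ), hN]
    field_simp at h2'
    linear_combination h2'

lemma bijOn_oddMap (hp : 1 ≤ p) :
    BijOn (oddMap σ) {q | q ∈ oddRange p σ ∧ (q.1, 0) ∈ band (muS σ 0) (muT σ 0)}
      (oddDomain p σ) := by
  refine ⟨fun q hq => mapsTo_oddMap hp hq.1, ?_, ?_⟩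
  · rintro ⟨t₁, α, a, φ⟩ ⟨⟨hα, ha, hs, hφ⟩, hb⟩ ⟨t₁', α', a', φ'⟩ ⟨⟨hα', ha', hs', hφ'⟩, hb'⟩ h
    have h' := congrArg hyperplane h
    rw [hyperplane_oddMap, hyperplane_oddMap] at h'
    obtain ⟨hu, hu₁, -, rfl, rfl⟩ := assemble_injective (U_pos (alphaRange_regular hα))
      (U_pos (alphaRange_regular hα')) ha ha' hs hs' hφ hφ' h'
    obtain ⟨rfl, rfl⟩ := oddCoordinates_unique hα hα' hb hb' hu hu₁
    rfl
  · intro y hy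
    obtain ⟨heta, hxi⟩ := mem_oddDomain_iff.1 hy
    obtain ⟨u, u₁, u₂, a, φ, hu, ha, hs, hφ, e⟩ := exists_assemble hp (hyperplane y)
      fun i => (eta_hyperplane_ne_zero_iff i y).2 (heta i)
    obtain rfl : u₂ = 0 := by
      have : assemble u u₁ u₂ a φ (Sum.inl 1) = 0 := by rw [e]; rfl
      simpa [hu.ne'] using this
    rw [Ne, xiOdd_eq_zero_iff (heta ⟨0, hp⟩)] at hxi
    obtain ⟨t₁, α, hb, hα, e₀, e₁⟩ := exists_oddCoordinates (σ := σ) (u₁ := u₁) hu fun _ hc => by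
      refine hxi ⟨?_, ?_⟩
      · change hyperplane y (Sum.inl 0) = 0
        rw [← e, assemble_inl_zero, hc.1]
        simp
      · change axialSq (hyperplane y) = σ
        rw [← e, axialSq_assemble _ _ _ _ hs]
        field_simp
        linarith [hc.2]
    refine ⟨(t₁, α, a, φ), ⟨⟨hα, ha, hs, hφ⟩, hb⟩, (hyperplaneIsometry p).injective ?_⟩
    change hyperplane (oddMap σ (t₁, α, a, φ)) = hyperplane y
    rw [hyperplane_oddMap, e₀, e₁, e]

lemma image_oddMap (hp : 1 ≤ p) : oddMap σ '' oddRange p σ = oddDomain p σ := by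
  refine (mapsTo_oddMap hp).image_subset.antisymm ?_
  rw [← (bijOn_oddMap hp).image_eq]
  exact image_mono fun q hq => hq.1

lemma oddDomain_eq : oddDomain p σ = {y | LinearIndependent ℝ
    (Sum.elim (fun _ : Fin 1 => xiOdd σ y) fun i : Fin p => eta i y)} := by
  ext y
  rw [mem_oddDomain_iff, mem_ofPred_eq]
  constructor
  · rintro ⟨hy, hxi⟩
    rw [Fintype.linearIndependent_iff]
    intro g hg
    have comp : ∀ A, g (Sum.inl 0) * xiOdd σ y A + ∑ i, g (Sum.inr i) * eta i y A = 0 := fun A => by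
      have := congrArg (fun w => w A) hg
      simpa [Fintype.sum_sum_type] using this
    have c2 := fun j => comp (Sum.inr (j, 0))
    have c3 := fun j => comp (Sum.inr (j, 1))
    simp only [xiOdd_inr, eta_inr_zero, mul_ite, mul_zero, Finset.sum_ite_eq,
      Finset.mem_univ, if_true] at c2
    simp only [xiOdd_inr, eta_inr_one, mul_ite, mul_zero, Finset.sum_ite_eq,
      Finset.mem_univ, if_true] at c3
    have hg' : ∀ j, g (Sum.inr j) = 0 := fun j => by
      refine (mul_eq_zero.1 ?_).resolve_right (axialSq_pos (hy j)).ne'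
      linear_combination y (Sum.inr (j, 0)) * c3 j - y (Sum.inr (j, 1)) * c2 j
    have h0 : g (Sum.inl 0) = 0 := by
      by_contra h0
      refine hxi (WithLp.ofLp_injective 2 (funext fun A => ?_))
      have := comp A
      simp only [hg', zero_mul, Finset.sum_const_zero, add_zero] at this
      exact (mul_eq_zero.1 this).resolve_left h0
    rintro (j | j)
    · rw [Subsingleton.elim j 0, h0]
    · exact hg' j
  · intro h
    exact ⟨fun i => h.ne_zero (Sum.inr i), h.ne_zero (Sum.inl 0)⟩

end Odd

end

end AdaptedCoordinates

open AdaptedCoordinates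

theorem mainTheorem5 (p : ℕ) (hp : 1 ≤ p) :
    -- even dimension `n = 2 p + 2 ≥ 4`
    (∀ (F : Matrix (Fin 2 ⊕ (Fin 2 ⊕ Fin p × Fin 2)) (Fin 2 ⊕ (Fin 2 ⊕ Fin p × Fin 2)) ℝ)
      (σ τ : ℝ) (μ : Fin p → ℝ), IsCanonicalEven F σ τ μ →
      -- the canonical decomposition
      (∀ y, ckvf F y = xiEven σ τ y + ∑ i, μ i • eta i y) ∧
      -- the limit of `U`
      (∀ t₁ t₂ α : ℝ, 0 < α →
        Tendsto (fun m : ℝ × ℝ => UGeneric m.1 m.2 t₁ t₂ α) (𝓝[≠] (0, 0))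
          (𝓝 (ULimit t₁ t₂ α))) ∧
      -- adapted coordinates and the metric
      (∀ (t₁ t₂ α : ℝ) (a φ : Fin p → ℝ), 0 < α → (∀ i, 0 < a i) → ∑ i, a i ^ 2 = 1 →
        0 < U (muS σ τ) (muT σ τ) t₁ t₂ α ∧
        IsLocalCoordinatesAt (evenConstraint p) (evenMap (muS σ τ) (muT σ τ))
          (t₁, t₂, α, a, φ) ∧
        HasDerivAt (fun s => evenChart (muS σ τ) (muT σ τ) s t₂ α a φ)
          (xiEven σ τ (evenChart (muS σ τ) (muT σ τ) t₁ t₂ α a φ)) t₁ ∧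
        HasDerivAt (fun s => evenChart (muS σ τ) (muT σ τ) t₁ s α a φ)
          (xiStarEven σ τ (evenChart (muS σ τ) (muT σ τ) t₁ t₂ α a φ)) t₂ ∧
        (∀ i, HasDerivAt
          (fun s => evenChart (muS σ τ) (muT σ τ) t₁ t₂ α a (Function.update φ i s))
          (eta i (evenChart (muS σ τ) (muT σ τ) t₁ t₂ α a φ)) (φ i)) ∧
        ∀ v : EvenParam p, ∑ i, a i * v.2.2.2.1 i = 0 →
          ‖fderiv ℝ (evenMap (muS σ τ) (muT σ τ)) (t₁, t₂, α, a, φ) v‖ ^ 2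
            = evenMetric (muS σ τ) (muT σ τ) t₁ t₂ α a v) ∧
      -- the region covered
      BijOn (evenMap (muS σ τ) (muT σ τ)) (evenRange p (muS σ τ) (muT σ τ))
        (evenDomain p σ τ) ∧
      -- its maximality
      evenDomain p σ τ =
        {y | LinearIndependent ℝ
          (Sum.elim ![xiEven σ τ y, xiStarEven σ τ y] fun i : Fin p => eta i y)}) ∧
    -- odd dimension `n = 2 p + 1 ≥ 3`
    (∀ (F : Matrix (Fin 2 ⊕ (Fin 1 ⊕ Fin p × Fin 2)) (Fin 2 ⊕ (Fin 1 ⊕ Fin p × Fin 2)) ℝ)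
      (σ : ℝ) (μ : Fin p → ℝ), IsCanonicalOdd F σ μ →
      -- the canonical decomposition
      (∀ y, ckvf F y = xiOdd σ y + ∑ i, μ i • eta i y) ∧
      -- adapted coordinates and the metric
      (∀ (t₁ α : ℝ) (a φ : Fin p → ℝ), α ∈ alphaRange σ → (∀ i, 0 < a i) → ∑ i, a i ^ 2 = 1 →
        evenChart (muS σ 0) (muT σ 0) t₁ 0 α a φ = hyperplane (oddChart σ t₁ α a φ) ∧
        U (muS σ 0) (muT σ 0) t₁ 0 α = UOdd σ t₁ α ∧
        0 < UOdd σ t₁ α ∧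
        IsLocalCoordinatesAt (oddConstraint p) (oddMap σ) (t₁, α, a, φ) ∧
        HasDerivAt (fun s => oddChart σ s α a φ) (xiOdd σ (oddChart σ t₁ α a φ)) t₁ ∧
        (∀ i, HasDerivAt (fun s => oddChart σ t₁ α a (Function.update φ i s))
          (eta i (oddChart σ t₁ α a φ)) (φ i)) ∧
        ∀ v : OddParam p, ∑ i, a i * v.2.2.1 i = 0 →
          ‖fderiv ℝ (oddMap σ) (t₁, α, a, φ) v‖ ^ 2
            = evenMetric (muS σ 0) (muT σ 0) t₁ 0 α a (v.1, 0, v.2.1, v.2.2.1, v.2.2.2) ∧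
          ‖fderiv ℝ (oddMap σ) (t₁, α, a, φ) v‖ ^ 2 = oddMetric σ t₁ α a v) ∧
      -- the region covered, with `t₁ ∈ ℝ`, and one-to-one with `(t₁, 0)` in the band
      oddMap σ '' oddRange p σ = oddDomain p σ ∧
      BijOn (oddMap σ) {q | q ∈ oddRange p σ ∧ (q.1, 0) ∈ band (muS σ 0) (muT σ 0)}
        (oddDomain p σ) ∧
      -- its maximality
      oddDomain p σ =
        {y | LinearIndependent ℝ
          (Sum.elim (fun _ : Fin 1 => xiOdd σ y) fun i : Fin p => eta i y)}) := by
  refine ⟨fun F σ τ μ hF => ⟨fun y => ?_, fun t₁ t₂ α hα => tendsto_UGeneric t₁ t₂ hα,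
    fun t₁ t₂ α a φ hα ha hs => ?_, bijOn_evenMap hp hF.tau_nonneg,
    evenDomain_eq hp hF.tau_nonneg⟩, fun F σ μ hF => ⟨fun y => ?_, fun t₁ α a φ hα ha hs => ?_,
    image_oddMap hp, bijOn_oddMap hp, oddDomain_eq⟩⟩
  · rw [hF.form]
    exact ckvf_canonical ..
  · have hσ := muS_sq_sub_muT_sq σ τ
    have hτ := two_mul_muS_mul_muT σ τ hF.tau_nonneg
    exact ⟨U_pos fun _ => hα, isLocalCoordinatesAt_evenMap hα ha hs,
      hasDerivAt_evenChart_one t₁ t₂ φ hσ hτ (fun _ => hα) hs,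
      hasDerivAt_evenChart_two t₁ t₂ φ hσ hτ (fun _ => hα) hs,
      hasDerivAt_evenChart_angle t₁ t₂ φ fun _ => hα,
      fun v hv => norm_fderiv_evenMap_sq (fun _ => hα) hs hv⟩
  · rw [hF.form]
    exact ckvf_canonical ..
  · have hm := fun (v : OddParam p) (hv : ∑ i, a i * v.2.2.1 i = 0) =>
      norm_fderiv_oddMap_sq (q := (t₁, α, a, φ)) hα hs hv
    exact ⟨(hyperplane_oddChart ..).symm, U_eq_UOdd .., U_eq_UOdd (σ := σ) t₁ α ▸
      U_pos (alphaRange_regular hα), isLocalCoordinatesAt_oddMap hα ha hs,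
      hasDerivAt_oddChart_one hα φ hs, hasDerivAt_oddChart_angle hα φ,
      fun v hv => ⟨hm v hv, (hm v hv).trans (evenMetric_eq_oddMetric ..)⟩⟩
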